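/- Let $N \ge 1$ be an integer, let $\mathcal{H} = L^2(\mathbb{R}^N, |x|^{-2}\,dx)$ (complex-valued functions), and let $\mathcal{D}$ be the complex linear span of the functions $r\omega \mapsto p(\omega) f(r)$ ($r > 0$, $|\omega| = 1$), where $p$ is a spherical harmonic on the unit sphere $S^{N-1}$ and $f \in C_c^\infty((0,\infty))$. Let $A_0$ be the operator $$A_0 F = 2 \sum_{j=1}^N x_j \frac{\partial F}{\partial x_j} + (N-2) F$$ on $\mathcal{H}$ with domain $\mathcal{D}$. Then $A_0$ is essentially skew-adjoint, that is, it is densely defined and closable and its closure $A$ satisfies $A^* = -A$, including the domain. Moreover, there is exactly one projection-valued measure $E$ on the Borel sets of $\mathbb{R}$ such that $\frac{1}{i} A = \int_{\mathbb{R}} \lambda \, dE(\lambda)$, including the domain. For every $t \in \mathbb{R}$, the operator $$\exp(tA) = \int_{\mathbb{R}} e^{it\lambda} \, dE(\lambda)$$ is unitary on $\mathcal{H}$, and it is given by scaling: for every $F \in \mathcal{H}$, $$\exp\Bigl(t\Bigl(2 \sum_{j=1}^N x_j \frac{\partial}{\partial x_j} + N - 2\Bigr)\Bigr) F(x) = \bigl(\exp(tA)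 F\bigr)(x) = e^{(N-2)t} F(e^{2t} x) \quad \text{for almost every } x \in \mathbb{R}^N.$$ -/

import Mathlib

open MeasureTheory Filter Topology
open scoped ContDiff InnerProductSpace

noncomputable section

namespace ScalingGroup

/-! ### Unbounded operators and the spectral functional calculus on a complex Hilbert space -/

section Abstract

variable {H : Type*} [NormedAddCommGroup H] [InnerProductSpace ℂ H]

/-- A projection-valued measure on the Borel sets of `ℝ` (with the value `0` on sets that are not
Borel, so that two such measures which agree on the Borel sets are equal). -/
@[ext]
structure ProjectionValuedMeasure (H : Type*) [NormedAddCommGroup H] [InnerProductSpace ℂ H]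
    [CompleteSpace H] where
  proj : Set ℝ → H →L[ℂ] H
  proj_of_not_measurable : ∀ B, ¬ MeasurableSet B → proj B = 0
  isStarProjection : ∀ B, MeasurableSet B → IsStarProjection (proj B)
  proj_univ : proj Set.univ = 1
  proj_inter : ∀ B C, MeasurableSet B → MeasurableSet C → proj (B ∩ C) = proj B * proj C
  hasSum_proj : ∀ B : ℕ → Set ℝ, (∀ n, MeasurableSet (B n)) →
    Pairwise (Function.onFun Disjoint B) →
      ∀ v : H, HasSum (fun n => proj (B n) v) (proj (⋃ n, B n) v)

variable [CompleteSpace H]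

namespace ProjectionValuedMeasure

theorem proj_empty (E : ProjectionValuedMeasure H) (v : H) : E.proj ∅ v = 0 := by
  have h := E.hasSum_proj (fun _ => ∅) (fun _ => MeasurableSet.empty)
    (fun _ _ _ => Set.disjoint_empty _) v
  exact tendsto_nhds_unique tendsto_const_nhds h.summable.tendsto_atTop_zero

theorem inner_eq (E : ProjectionValuedMeasure H) (v : H) {B : Set ℝ} (hB : MeasurableSet B) :
    ⟪v, E.proj B v⟫_ℂ = ((‖E.proj B v‖ ^ 2 : ℝ) : ℂ) := by
  have h := E.isStarProjection B hB
  have h1 : E.proj B (E.proj B v) = E.proj B v :=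
    congrArg (fun T : H →L[ℂ] H => T v) h.isIdempotentElem.eq
  have h2 : ContinuousLinearMap.adjoint (E.proj B) = E.proj B := h.isSelfAdjoint
  calc ⟪v, E.proj B v⟫_ℂ = ⟪v, E.proj B (E.proj B v)⟫_ℂ := by rw [h1]
    _ = ⟪E.proj B v, E.proj B v⟫_ℂ := by
        rw [← ContinuousLinearMap.adjoint_inner_left, h2]
    _ = _ := by rw [inner_self_eq_norm_sq_to_K]; push_cast; rfl

/-- The scalar spectral measure `B ↦ ⟪v, E(B) v⟫ = ‖E(B) v‖²` of the vector `v`. -/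
def scalarMeasure (E : ProjectionValuedMeasure H) (v : H) : Measure ℝ :=
  Measure.ofMeasurable (fun B _ => ENNReal.ofReal (‖E.proj B v‖ ^ 2))
    (by simp [E.proj_empty v])
    (by
      intro B hB hd
      have h := E.hasSum_proj B hB hd v
      have h2 := (h.mapL (innerSL ℂ v))
      simp only [innerSL_apply_apply] at h2
      rw [E.inner_eq v (MeasurableSet.iUnion hB)] at h2
      simp only [E.inner_eq v (hB _)] at h2
      have h3 := Complex.hasSum_ofReal.mp h2
      rw [← h3.tsum_eq, ENNReal.ofReal_tsum_of_nonneg (fun n => by positivity) h3.summable])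

/-- The scalar spectral measure of `v` has the value `⟪v, E(B) v⟫` at a Borel set `B`. -/
theorem scalarMeasure_apply (E : ProjectionValuedMeasure H) (v : H) {B : Set ℝ}
    (hB : MeasurableSet B) :
    ((E.scalarMeasure v B).toReal : ℂ) = ⟪v, E.proj B v⟫_ℂ := by
  rw [scalarMeasure, Measure.ofMeasurable_apply _ hB, E.inner_eq v hB,
    ENNReal.toReal_ofReal (by positivity)]

/-- `T = ∫ φ dE`, for a bounded Borel function `φ` and a bounded operator `T`. -/
def IsIntegral (E : ProjectionValuedMeasure H) (φ : ℝ → ℂ) (T : H →L[ℂ] H) : Prop :=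
  ∀ v : H, ⟪v, T v⟫_ℂ = ∫ l, φ l ∂(E.scalarMeasure v)

/-- The bounded operator `∫ φ dE` of a bounded Borel function `φ`; by polarization at most one
bounded operator satisfies the condition. -/
def integral (E : ProjectionValuedMeasure H) (φ : ℝ → ℂ) : H →L[ℂ] H :=
  open Classical in if h : ∃ T, E.IsIntegral φ T then h.choose else 0

/-- `E` is the spectral measure of the (unbounded) operator `T`, that is, `T = ∫ l dE(l)`
including the domain: `v` is in the domain of `T` if and only if `∫ l² d⟪v, E(l) v⟫` is finite,
and `⟪v, T v⟫ = ∫ l d⟪v, E(l) v⟫` for such `v`. -/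
def IsSpectralMeasureOf (E : ProjectionValuedMeasure H) (T : H →ₗ.[ℂ] H) : Prop :=
  (∀ v : H, v ∈ T.domain ↔ Integrable (fun l : ℝ => l ^ 2) (E.scalarMeasure v)) ∧
    ∀ v : T.domain, ⟪(v : H), T v⟫_ℂ = ((∫ l, l ∂(E.scalarMeasure (v : H)) : ℝ) : ℂ)

end ProjectionValuedMeasure

/-- A densely defined closable operator `T` is essentially skew-adjoint if the adjoint of its
closure is minus its closure, including the domain. -/
def IsEssentiallySkewAdjoint (T : H →ₗ.[ℂ] H) : Prop :=
  Dense (T.domain : Set H) ∧ T.IsClosable ∧ T.closure.adjoint = -T.closure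

/-- `exp(t A)` for a skew-adjoint operator `A`, by the spectral functional calculus: the integral
`∫ exp(i t l) dE(l)`, where `E` is the spectral measure of the self-adjoint operator `i⁻¹ A`. -/
def expSkew (A : H →ₗ.[ℂ] H) (t : ℝ) : H →L[ℂ] H :=
  open Classical in
  if h : ∃ E : ProjectionValuedMeasure H, E.IsSpectralMeasureOf (Complex.I⁻¹ • A) then
    h.choose.integral (fun l => Complex.exp (Complex.I * t * l))
  else 0

end Abstract

/-! ### The Hilbert space `L²(ℝ^N, |x|⁻² dx)` -/

/-- The measure `|x|⁻² dx` on `ℝ^N`. -/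
def invSqMeasure (N : ℕ) : Measure (EuclideanSpace ℝ (Fin N)) :=
  volume.withDensity (fun x => ENNReal.ofReal ((‖x‖ ^ 2)⁻¹))

/-- The complex Hilbert space `L²(ℝ^N, |x|⁻² dx)`. -/
abbrev L2Space (N : ℕ) : Type := Lp ℂ 2 (invSqMeasure N)

/-! ### Spherical harmonics and the domain -/

/-- The Laplacian on complex polynomials in `N` variables. -/
def polyLaplacian (N : ℕ) : MvPolynomial (Fin N) ℂ →ₗ[ℂ] MvPolynomial (Fin N) ℂ :=
  ∑ j, (MvPolynomial.pderiv j).toLinearMap ∘ₗ (MvPolynomial.pderiv j).toLinearMap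

/-- The restriction of a polynomial to the unit sphere. -/
def restrictSphere (N : ℕ) : MvPolynomial (Fin N) ℂ →ₗ[ℂ]
    (Metric.sphere (0 : EuclideanSpace ℝ (Fin N)) 1 → ℂ) where
  toFun P := fun w => MvPolynomial.eval (fun j => (((w : EuclideanSpace ℝ (Fin N)) j : ℝ) : ℂ)) P
  map_add' P Q := by ext; simp
  map_smul' c P := by ext; simp

/-- The spherical harmonics of degree `m`: restrictions to the sphere of the harmonic homogeneous
polynomials of degree `m`. -/
def sphericalHarmonicsDeg (N m : ℕ) :
    Submodule ℂ (Metric.sphere (0 : EuclideanSpace ℝ (Fin N)) 1 → ℂ) :=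
  (MvPolynomial.homogeneousSubmodule (Fin N) ℂ m ⊓ LinearMap.ker (polyLaplacian N)).map
    (restrictSphere N)

/-- The space of all spherical harmonics. -/
def sphericalHarmonics (N : ℕ) :
    Submodule ℂ (Metric.sphere (0 : EuclideanSpace ℝ (Fin N)) 1 → ℂ) :=
  ⨆ m, sphericalHarmonicsDeg N m

/-- The function `p ⊗ f : r ω ↦ p(ω) f(r)` for `r > 0` and `|ω| = 1` (with the value `0` at the
origin). -/
def sphTensor {N : ℕ} (p : Metric.sphere (0 : EuclideanSpace ℝ (Fin N)) 1 → ℂ) (f : ℝ → ℂ) :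
    EuclideanSpace ℝ (Fin N) → ℂ :=
  open Classical in
  fun x => if hx : x ≠ 0 then
    p ⟨‖x‖⁻¹ • x, by rw [mem_sphere_zero_iff_norm]; exact norm_smul_inv_norm (𝕜 := ℝ) hx⟩
      * f ‖x‖
  else 0

/-- The space `C_c^∞((0, ∞))`, as functions on `ℝ` that vanish off a compact subset of
`(0, ∞)`. -/
def IsRadialTest (f : ℝ → ℂ) : Prop :=
  ContDiff ℝ ∞ f ∧ HasCompactSupport f ∧ tsupport f ⊆ Set.Ioi 0

/-- The domain `𝒟`, the linear span of the functions `p ⊗ f` with `p` a spherical harmonic and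
`f ∈ C_c^∞((0, ∞))`. -/
def testDomain (N : ℕ) : Submodule ℂ (EuclideanSpace ℝ (Fin N) → ℂ) :=
  Submodule.span ℂ {F | ∃ p ∈ sphericalHarmonics N, ∃ f, IsRadialTest f ∧ F = sphTensor p f}

/-! ### The differential operator -/

/-- The differential expression `2 ∑ⱼ xⱼ ∂F/∂xⱼ + (N - 2) F`. -/
def eulerExpr {N : ℕ} (F : EuclideanSpace ℝ (Fin N) → ℂ) : EuclideanSpace ℝ (Fin N) → ℂ :=
  fun x => 2 * ∑ j, ((x j : ℝ) : ℂ) * fderiv ℝ F x (EuclideanSpace.single j 1)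
    + ((N : ℂ) - 2) * F x

/-- Smooth functions on `ℝ^N` with compact support that does not contain the origin. -/
def puncturedTest (N : ℕ) : Submodule ℂ (EuclideanSpace ℝ (Fin N) → ℂ) where
  carrier := {F | ContDiff ℝ ∞ F ∧ HasCompactSupport F ∧ (0 : EuclideanSpace ℝ (Fin N)) ∉ tsupport F}
  zero_mem' := by
    refine ⟨contDiff_const, HasCompactSupport.zero, ?_⟩
    simp
  add_mem' := by
    rintro F G ⟨h1, h2, h3⟩ ⟨k1, k2, k3⟩
    exact ⟨h1.add k1, h2.add k2, fun h => (tsupport_add F G h).elim h3 k3⟩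
  smul_mem' := by
    rintro c F ⟨h1, h2, h3⟩
    exact ⟨h1.const_smul c, h2.smul_left (f := fun _ => c),
      fun h => h3 (tsupport_smul_subset_right (fun _ => c) F h)⟩

theorem exists_poly_of_mem {N : ℕ} {p : Metric.sphere (0 : EuclideanSpace ℝ (Fin N)) 1 → ℂ}
    (hp : p ∈ sphericalHarmonics N) : ∃ P, restrictSphere N P = p := by
  have h : sphericalHarmonics N ≤ LinearMap.range (restrictSphere N) :=
    iSup_le fun m => LinearMap.map_le_range
  exact h hp

theorem contDiffAt_eval {N : ℕ} (P : MvPolynomial (Fin N) ℂ) {x : EuclideanSpace ℝ (Fin N)}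
    (hx : x ≠ 0) :
    ContDiffAt ℝ ∞ (fun y : EuclideanSpace ℝ (Fin N) =>
      MvPolynomial.eval (fun j => (((‖y‖⁻¹ • y) j : ℝ) : ℂ)) P) x := by
  induction P using MvPolynomial.induction_on with
  | C a => simpa using contDiffAt_const
  | add P Q hP hQ => simpa using hP.add hQ
  | mul_X P j hP =>
    have h1 : ContDiffAt ℝ ∞ (fun y : EuclideanSpace ℝ (Fin N) => (((‖y‖⁻¹ • y) j : ℝ) : ℂ)) x := by
      have h2 : ContDiffAt ℝ ∞ (fun y : EuclideanSpace ℝ (Fin N) => ‖y‖⁻¹ • y) x :=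
        ((contDiffAt_norm ℝ hx).inv (norm_ne_zero_iff.mpr hx)).smul contDiffAt_id
      have h3 : ContDiffAt ℝ ∞ (fun y : EuclideanSpace ℝ (Fin N) => (‖y‖⁻¹ • y) j) x :=
        (EuclideanSpace.proj (𝕜 := ℝ) j).contDiff.contDiffAt.comp x h2
      exact Complex.ofRealCLM.contDiff.contDiffAt.comp x h3
    simpa using hP.mul h1

theorem sphTensor_mem {N : ℕ} {p : Metric.sphere (0 : EuclideanSpace ℝ (Fin N)) 1 → ℂ}
    (hp : p ∈ sphericalHarmonics N) {f : ℝ → ℂ} (hf : IsRadialTest f) :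
    sphTensor p f ∈ puncturedTest N := by
  obtain ⟨P, rfl⟩ := exists_poly_of_mem hp
  obtain ⟨f1, f2, f3⟩ := hf
  have f0 : (0 : ℝ) ∉ tsupport f := fun h => lt_irrefl (0 : ℝ) (f3 h)
  have hsub : Function.support (sphTensor (restrictSphere N P) f) ⊆ (fun x => ‖x‖) ⁻¹' tsupport f := by
    intro x hx
    by_contra h
    apply hx
    have : f ‖x‖ = 0 := image_eq_zero_of_notMem_tsupport h
    simp [sphTensor, this]
  have hclosed : IsClosed ((fun x : EuclideanSpace ℝ (Fin N) => ‖x‖) ⁻¹' tsupport f) :=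
    (isClosed_tsupport f).preimage continuous_norm
  have hts := closure_minimal hsub hclosed
  have h0 : (0 : EuclideanSpace ℝ (Fin N)) ∉ tsupport (sphTensor (restrictSphere N P) f) :=
    fun h => f0 (by simpa using hts h)
  refine ⟨?_, ?_, h0⟩
  · rw [contDiff_iff_contDiffAt]
    intro x
    by_cases hx : x = 0
    · subst hx
      have : sphTensor (restrictSphere N P) f =ᶠ[𝓝 0] 0 := notMem_tsupport_iff_eventuallyEq.mp h0
      exact (contDiffAt_const (c := (0 : ℂ))).congr_of_eventuallyEq this
    · have h1 : ContDiffAt ℝ ∞ (fun y : EuclideanSpace ℝ (Fin N) => f ‖y‖) x :=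
        f1.contDiffAt.comp x (contDiffAt_norm ℝ hx)
      refine ((contDiffAt_eval P hx).mul h1).congr_of_eventuallyEq ?_
      filter_upwards [isOpen_ne.mem_nhds hx] with y hy
      have hy' : y ≠ 0 := hy
      simp [sphTensor, hy', restrictSphere]
  · obtain ⟨R, hR⟩ := f2.isBounded.subset_closedBall 0
    refine HasCompactSupport.of_support_subset_isCompact
      (isCompact_closedBall (0 : EuclideanSpace ℝ (Fin N)) R) (hsub.trans fun x hx => ?_)
    simpa using hR hx

theorem testDomain_le (N : ℕ) : testDomain N ≤ puncturedTest N := by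
  refine Submodule.span_le.mpr ?_
  rintro F ⟨p, hp, f, hf, rfl⟩
  exact sphTensor_mem hp hf

theorem memLp_of_punctured {N : ℕ} {G : EuclideanSpace ℝ (Fin N) → ℂ} (h1 : Continuous G)
    (h2 : HasCompactSupport G) (h3 : (0 : EuclideanSpace ℝ (Fin N)) ∉ tsupport G) :
    MemLp G 2 (invSqMeasure N) := by
  have hK : IsCompact (tsupport G) := h2
  have hm : MeasurableSet (tsupport G) := (isClosed_tsupport G).measurableSet
  have hfin : invSqMeasure N (tsupport G) < ⊤ := by
    rw [invSqMeasure, withDensity_apply _ hm]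
    have hc : ContinuousOn (fun x : EuclideanSpace ℝ (Fin N) => (‖x‖ ^ 2)⁻¹) (tsupport G) := by
      refine ContinuousOn.inv₀ (by fun_prop) fun x hx => ?_
      have : x ≠ 0 := fun h => h3 (h ▸ hx)
      positivity
    exact (hc.integrableOn_compact hK).lintegral_lt_top
  have hfm : IsFiniteMeasure ((invSqMeasure N).restrict (tsupport G)) :=
    ⟨by rwa [Measure.restrict_apply_univ]⟩
  obtain ⟨C, hC⟩ := h1.bounded_above_of_compact_support h2
  have h4 : MemLp G 2 ((invSqMeasure N).restrict (tsupport G)) :=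
    MemLp.of_bound h1.aestronglyMeasurable C (ae_of_all _ hC)
  have h5 := (memLp_indicator_iff_restrict hm).mpr h4
  rwa [Set.indicator_eq_self.mpr (subset_tsupport G)] at h5

theorem eulerExpr_memLp {N : ℕ} {F : EuclideanSpace ℝ (Fin N) → ℂ} (hF : F ∈ puncturedTest N) :
    MemLp (eulerExpr F) 2 (invSqMeasure N) := by
  obtain ⟨h1, h2, h3⟩ := hF
  have hsub : tsupport (eulerExpr F) ⊆ tsupport F := by
    refine closure_minimal (fun x hx => ?_) (isClosed_tsupport F)
    by_contra h
    apply hx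
    have ha : F x = 0 := image_eq_zero_of_notMem_tsupport h
    have hb : fderiv ℝ F x = 0 :=
      image_eq_zero_of_notMem_tsupport fun hc => h (tsupport_fderiv_subset ℝ hc)
    simp [eulerExpr, ha, hb]
  have hd : Continuous (fderiv ℝ F) := h1.continuous_fderiv (by simp)
  have hc : Continuous F := h1.continuous
  refine memLp_of_punctured ?_ (h2.of_isClosed_subset (isClosed_tsupport _) hsub)
    fun h => h3 (hsub h)
  unfold eulerExpr
  fun_prop

theorem eq_of_ae_eq {N : ℕ} {F : EuclideanSpace ℝ (Fin N) → ℂ} (hF : F ∈ puncturedTest N)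
    (h : F =ᵐ[invSqMeasure N] 0) : F = 0 := by
  obtain ⟨h1, h2, h3⟩ := hF
  have hm : Measurable (fun x : EuclideanSpace ℝ (Fin N) => ENNReal.ofReal ((‖x‖ ^ 2)⁻¹)) := by
    fun_prop
  have h4 := (ae_withDensity_iff hm).mp h
  refine (Continuous.ae_eq_iff_eq volume h1.continuous continuous_zero).mp ?_
  filter_upwards [h4] with x hx
  by_cases h0 : x = 0
  · rw [h0]
    exact image_eq_zero_of_notMem_tsupport h3
  · refine hx ?_
    rw [Ne, ENNReal.ofReal_eq_zero, not_le]
    positivity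

theorem memLp_of_mem {N : ℕ} {F : EuclideanSpace ℝ (Fin N) → ℂ} (hF : F ∈ testDomain N) :
    MemLp F 2 (invSqMeasure N) :=
  have h := testDomain_le N hF
  memLp_of_punctured h.1.continuous h.2.1 h.2.2

/-- The inclusion of `𝒟` in `L²(ℝ^N, |x|⁻² dx)`. -/
def toL2 (N : ℕ) : testDomain N →ₗ[ℂ] L2Space N where
  toFun F := (memLp_of_mem F.2).toLp (F : EuclideanSpace ℝ (Fin N) → ℂ)
  map_add' _ _ := rfl
  map_smul' _ _ := rfl

theorem toL2_injective (N : ℕ) : Function.Injective (toL2 N) := by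
  rw [← LinearMap.ker_eq_bot, LinearMap.ker_eq_bot']
  intro F hF
  have h : (toL2 N F : EuclideanSpace ℝ (Fin N) → ℂ) =ᵐ[invSqMeasure N] 0 := by
    rw [hF]
    exact Lp.coeFn_zero ℂ 2 (invSqMeasure N)
  exact Subtype.ext (eq_of_ae_eq (testDomain_le N F.2) ((memLp_of_mem F.2).coeFn_toLp.symm.trans h))

/-- `2 ∑ⱼ xⱼ ∂/∂xⱼ + N - 2` as a linear map from `𝒟` to `L²(ℝ^N, |x|⁻² dx)`. -/
def eulerToL2 (N : ℕ) : testDomain N →ₗ[ℂ] L2Space N where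
  toFun F := (eulerExpr_memLp (testDomain_le N F.2)).toLp (eulerExpr F)
  map_add' F G := by
    have hF : Differentiable ℝ (F : EuclideanSpace ℝ (Fin N) → ℂ) :=
      (testDomain_le N F.2).1.differentiable (by simp)
    have hG : Differentiable ℝ (G : EuclideanSpace ℝ (Fin N) → ℂ) :=
      (testDomain_le N G.2).1.differentiable (by simp)
    rw [← MemLp.toLp_add]
    congr 1
    funext x
    simp only [eulerExpr, Submodule.coe_add, fderiv_add (hF x) (hG x), Pi.add_apply,
      add_apply, mul_add, Finset.sum_add_distrib]
    ring
  map_smul' c F := by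
    have hF : Differentiable ℝ (F : EuclideanSpace ℝ (Fin N) → ℂ) :=
      (testDomain_le N F.2).1.differentiable (by simp)
    rw [RingHom.id_apply, ← MemLp.toLp_const_smul]
    congr 1
    funext x
    simp only [eulerExpr, Submodule.coe_smul, fderiv_const_smul (hF x), Pi.smul_apply,
      smul_apply, smul_eq_mul, mul_add, Finset.mul_sum]
    congr 1
    · exact Finset.sum_congr rfl fun j _ => by ring
    · ring

/-- The operator `2 ∑ⱼ xⱼ ∂/∂xⱼ + N - 2` with the domain `𝒟` (included in
`L²(ℝ^N, |x|⁻² dx)`), as an unbounded operator on `L²(ℝ^N, |x|⁻² dx)`. -/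
def eulerOp (N : ℕ) : L2Space N →ₗ.[ℂ] L2Space N where
  domain := LinearMap.range (toL2 N)
  toFun := eulerToL2 N ∘ₗ (LinearEquiv.ofInjective (toL2 N) (toL2_injective N)).symm.toLinearMap

end ScalingGroup

end

noncomputable section

namespace ScalingGroup

/-! ### Spherical harmonics exhaust the polynomial functions on the sphere -/

section Harmonics

open MvPolynomial

variable {N : ℕ}

/-! In the coordinates `x = e^{2s} ω` the measure `|x|⁻² dx` becomes `2 e^{2(N-2)s} ds dσ(ω)`. Hence
`F ↦ √2 e^{(N-2)s} F(e^{2s} ·)` (`logPolar`) is isometric into `L²(ℝ; K)`, where `K` is the closure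
of the spherical harmonics in `L²` of the sphere. It turns the scaling by `t` into the translation
`s ↦ s + t`, and the Euler operator into `d/ds`. The Fourier transform then turns these into
multiplication by `e^{itl}` and by `il`, where `l = 2πξ`. The composite is `mellin`, and the theorem
becomes one about multiplication operators, for which skew-adjointness, a spectral measure
(`mulPVM`) and the unitary group (`expOp`) are explicit.

Three points need an argument.

Density of the domain (`denseRange_toL2`), without which `mellin` is not defined on the whole space.
Every polynomial restricted to the sphere is a sum of spherical harmonics, since Δ has a right
inverse on sums of `|x|^{2j} h` with `h` harmonic (`mem_harmonicSpan`); so the domain contains all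
products of polynomials and radial test functions, and Stone–Weierstrass applies. Density of the
image (`denseRange_logPolarToLp`) is easier, because `K` is by definition no larger than what the
harmonics generate.

The closure of the operator is the maximal multiplication operator (`closure_eq_mulSkew`). This is
Nelson's criterion: the domain is invariant under the group `U_t`, so for `w` orthogonal to the
range of `A₀ - 1` the function `g(t) = ⟪w, U_t f⟫` satisfies `g' = g`; being bounded, it is zero.
Thus `A₀ - 1` has dense range, and `‖(A - 1)v‖² = ‖Av‖² + ‖v‖²` turns this into density in the graph
norm.

Uniqueness of the spectral measure (`IsSpectralMeasureOf.eq_of_lower_bound`), where only the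
quadratic form of `T = i⁻¹A` is prescribed. Polarization shows that `T` preserves the ranges of the
projections of `E`, and `‖T - c‖ ≤ ε` on the range of `E([c-ε, c+ε])`. For the multiplication
measure `F`, the operator `T - c` is bounded below by `δ` off `(c-δ, c+δ)`. Iterating `T - c` with
`ε < δ` shows that the first range lies in that of `F((c-δ, c+δ))`, and such comparisons on
intervals force `E = F`. -/

theorem polyLaplacian_apply (P : MvPolynomial (Fin N) ℂ) :
    polyLaplacian N P = ∑ j, pderiv j (pderiv j P) := by
  simp [polyLaplacian]

/-- The squared norm as a polynomial. -/
def normSqPoly (N : ℕ) : MvPolynomial (Fin N) ℂ := ∑ j, X j ^ 2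

theorem normSqPoly_isHomogeneous : (normSqPoly N).IsHomogeneous 2 :=
  IsHomogeneous.sum _ _ _ fun j _ => isHomogeneous_X_pow j 2

theorem pderiv_normSqPoly (i : Fin N) : pderiv i (normSqPoly N) = 2 * X i := by
  simp only [normSqPoly, map_sum, Derivation.leibniz_pow, pderiv_X]
  simp [Pi.single_apply]

/-- By Leibniz: `Δ|x|² = 2N`, and the cross term `4 ∑ xᵢ ∂ᵢG` equals `4dG` by Euler's identity. -/
theorem polyLaplacian_normSqPoly_mul {d : ℕ} {G : MvPolynomial (Fin N) ℂ}
    (hG : G.IsHomogeneous d) :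
    polyLaplacian N (normSqPoly N * G) =
      normSqPoly N * polyLaplacian N G + ((2 * N + 4 * d : ℕ) : ℂ) • G := by
  have h1 : ∀ i : Fin N, pderiv i (pderiv i (normSqPoly N * G)) =
      normSqPoly N * pderiv i (pderiv i G) + 4 * (X i * pderiv i G) + 2 * G := by
    intro i
    have h2 : pderiv i (2 : MvPolynomial (Fin N) ℂ) = 0 := by
      simpa using (pderiv i).map_natCast (A := MvPolynomial (Fin N) ℂ) 2
    simp only [Derivation.leibniz, pderiv_normSqPoly, map_add, smul_eq_mul, h2, pderiv_X_self]
    ring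
  rw [polyLaplacian_apply, polyLaplacian_apply, Finset.sum_congr rfl fun i _ => h1 i,
    Finset.sum_add_distrib, Finset.sum_add_distrib, ← Finset.mul_sum, ← Finset.mul_sum,
    hG.sum_X_mul_pderiv]
  simp only [Finset.sum_const, Finset.card_univ, Fintype.card_fin, nsmul_eq_mul, smul_eq_C_mul,
    map_natCast]
  push_cast
  ring

/-- The homogeneous harmonic polynomials of degree `m`. -/
def harmonicPoly (N m : ℕ) : Submodule ℂ (MvPolynomial (Fin N) ℂ) :=
  homogeneousSubmodule (Fin N) ℂ m ⊓ LinearMap.ker (polyLaplacian N)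

/-- Each further factor `|x|²` adds `2N + 4 · degree` to the constant. Since `N ≥ 1`, it is positive
even for constant `h`, so it can be divided out when Δ is inverted. -/
theorem polyLaplacian_normSqPoly_pow_mul (hN : 1 ≤ N) {k : ℕ} {h : MvPolynomial (Fin N) ℂ}
    (hh : h ∈ harmonicPoly N k) (j : ℕ) :
    ∃ c : ℕ, 0 < c ∧ polyLaplacian N (normSqPoly N ^ (j + 1) * h) =
      (c : ℂ) • (normSqPoly N ^ j * h) := by
  obtain ⟨h1, h2⟩ := hh
  have h1 : h.IsHomogeneous k := h1
  have h2 : polyLaplacian N h = 0 := h2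
  induction j with
  | zero =>
    refine ⟨2 * N + 4 * k, by omega, ?_⟩
    rw [zero_add, pow_one, polyLaplacian_normSqPoly_mul h1, h2, mul_zero, zero_add, pow_zero,
      one_mul]
  | succ j ih =>
    obtain ⟨c, hc, h3⟩ := ih
    have h4 : (normSqPoly N ^ (j + 1) * h).IsHomogeneous (2 * (j + 1) + k) :=
      (normSqPoly_isHomogeneous.pow (j + 1)).mul h1
    refine ⟨c + (2 * N + 4 * (2 * (j + 1) + k)), by omega, ?_⟩
    rw [pow_succ' _ (j + 1), mul_assoc, polyLaplacian_normSqPoly_mul h4, h3, Nat.cast_add c,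
      add_smul]
    congr 1
    rw [mul_smul_comm]
    congr 1
    ring

/-- The span of the products of a power of `|x|²` and a harmonic polynomial, of total
degree `m`. -/
def harmonicSpan (N m : ℕ) : Submodule ℂ (MvPolynomial (Fin N) ℂ) :=
  Submodule.span ℂ {G | ∃ j k, 2 * j + k = m ∧ ∃ h ∈ harmonicPoly N k, G = normSqPoly N ^ j * h}

theorem harmonicSpan_le (m : ℕ) : harmonicSpan N m ≤ homogeneousSubmodule (Fin N) ℂ m := by
  refine Submodule.span_le.mpr ?_
  rintro _ ⟨j, k, rfl, h, hh, rfl⟩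
  exact (normSqPoly_isHomogeneous.pow j).mul hh.1

theorem exists_polyLaplacian_eq (hN : 1 ≤ N) {m : ℕ} {G : MvPolynomial (Fin N) ℂ}
    (hG : G ∈ harmonicSpan N m) : ∃ Q ∈ harmonicSpan N (m + 2), polyLaplacian N Q = G := by
  have : harmonicSpan N m ≤ (harmonicSpan N (m + 2)).map (polyLaplacian N) := by
    refine Submodule.span_le.mpr ?_
    rintro _ ⟨j, k, rfl, h, hh, rfl⟩
    obtain ⟨c, hc, h3⟩ := polyLaplacian_normSqPoly_pow_mul hN hh j
    refine ⟨(c : ℂ)⁻¹ • (normSqPoly N ^ (j + 1) * h),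
      Submodule.smul_mem _ _ (Submodule.subset_span ⟨j + 1, k, by ring, h, hh, rfl⟩), ?_⟩
    rw [map_smul, h3, smul_smul, inv_mul_cancel₀ (by exact_mod_cast hc.ne'), one_smul]
  exact this hG

/-- Induction in steps of two degrees: `ΔP` is in the span by induction, hence equal to `ΔQ` for
some `Q` in the span, and `P - Q` is harmonic. -/
theorem mem_harmonicSpan (hN : 1 ≤ N) (m : ℕ) (P : MvPolynomial (Fin N) ℂ)
    (hP : P.IsHomogeneous m) : P ∈ harmonicSpan N m := by
  have key : ∀ (m : ℕ) (P : MvPolynomial (Fin N) ℂ), P ∈ harmonicPoly N m →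
      P ∈ harmonicSpan N m := fun m P h =>
    Submodule.subset_span ⟨0, m, by ring, P, h, by simp⟩
  have hΔ : (polyLaplacian N P).IsHomogeneous (m - 1 - 1) := by
    rw [polyLaplacian_apply]
    exact IsHomogeneous.sum _ _ _ fun j _ => hP.pderiv.pderiv
  induction m using Nat.strong_induction_on generalizing P with
  | _ m ih =>
    -- In degree below two the first derivatives are constant, so `P` is already harmonic.
    by_cases hm : m < 2
    · refine key m P ⟨hP, ?_⟩
      change polyLaplacian N P = 0
      rw [polyLaplacian_apply]
      refine Finset.sum_eq_zero fun j _ => ?_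
      have h0 : (pderiv j P).IsHomogeneous 0 := by
        have := hP.pderiv (i := j)
        rwa [show m - 1 = 0 by omega] at this
      rw [totalDegree_eq_zero_iff_eq_C.mp (Nat.le_zero.mp h0.totalDegree_le), pderiv_C]
    · obtain ⟨n, rfl⟩ : ∃ n, m = n + 2 := ⟨m - 2, by omega⟩
      have hΔ' : (polyLaplacian N P).IsHomogeneous n := by simpa using hΔ
      have h1 := ih n (by omega) _ hΔ' (by
        rw [polyLaplacian_apply]
        exact IsHomogeneous.sum _ _ _ fun j _ => hΔ'.pderiv.pderiv)
      obtain ⟨Q, hQ, hQP⟩ := exists_polyLaplacian_eq hN h1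
      have h2 : P - Q ∈ harmonicPoly N (n + 2) := by
        refine ⟨Submodule.sub_mem _ hP (harmonicSpan_le _ hQ), ?_⟩
        change polyLaplacian N (P - Q) = 0
        rw [map_sub, hQP, sub_self]
      simpa using Submodule.add_mem _ (key _ _ h2) hQ

theorem restrictSphere_normSqPoly : restrictSphere N (normSqPoly N) = 1 := by
  funext w
  have h : ‖(w : EuclideanSpace ℝ (Fin N))‖ ^ 2 = 1 := by simp
  rw [EuclideanSpace.norm_sq_eq] at h
  simp only [Real.norm_eq_abs, sq_abs] at h
  simp only [restrictSphere, normSqPoly, LinearMap.coe_mk, AddHom.coe_mk, map_sum, map_pow,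
    eval_X, Pi.one_apply, Finset.sum_apply]
  exact_mod_cast h

theorem restrictSphere_mul (P Q : MvPolynomial (Fin N) ℂ) :
    restrictSphere N (P * Q) = restrictSphere N P * restrictSphere N Q := by
  ext w; simp [restrictSphere]

/-- On the sphere the factors `|x|²` of the harmonic decomposition are `1` and drop out. -/
theorem restrictSphere_mem (hN : 1 ≤ N) (P : MvPolynomial (Fin N) ℂ) :
    restrictSphere N P ∈ sphericalHarmonics N := by
  have h1 : ∀ m, harmonicSpan N m ≤ (sphericalHarmonics N).comap (restrictSphere N) := by
    intro m
    refine Submodule.span_le.mpr ?_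
    rintro _ ⟨j, k, -, h, hh, rfl⟩
    have h2 : restrictSphere N (normSqPoly N ^ j * h) = restrictSphere N h := by
      induction j with
      | zero => simp
      | succ j ih => rw [pow_succ', mul_assoc, restrictSphere_mul, restrictSphere_normSqPoly,
          one_mul, ih]
    change restrictSphere N (normSqPoly N ^ j * h) ∈ sphericalHarmonics N
    rw [h2]
    exact (le_iSup (sphericalHarmonicsDeg N) k) (Submodule.mem_map_of_mem hh)
  rw [← sum_homogeneousComponent P, map_sum]
  exact Submodule.sum_mem _ fun m _ =>
    h1 m (mem_harmonicSpan hN m _ (homogeneousComponent_isHomogeneous m P))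

end Harmonics

/-! ### Uniqueness of the spectral measure -/

section Sesquilinear

variable {M H : Type*} [AddCommGroup M] [Module ℂ M] [NormedAddCommGroup H]
  [InnerProductSpace ℂ H]

/-- Complex polarization. Integrals and spectral measures are defined through quadratic forms only,
and this recovers the operators. -/
theorem sesqForm_eq_zero_of_diag (B : M →ₗ⋆[ℂ] M →ₗ[ℂ] ℂ) (h : ∀ x, B x x = 0) (x y : M) :
    B x y = 0 := by
  have h1 := h (x + y)
  have h2 := h (x + Complex.I • y)
  simp only [map_add, LinearMap.add_apply, map_smulₛₗ, LinearMap.smul_apply, h, smul_eq_mul,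
    Complex.conj_I, RingHom.id_apply] at h1 h2
  have h3 : 2 * Complex.I * B x y = 0 := by linear_combination h2 + Complex.I * h1
  simpa using h3

/-- The sesquilinear form `(x, y) ↦ ⟪a x, b y⟫`. -/
def innerForm (a b : M →ₗ[ℂ] H) : M →ₗ⋆[ℂ] M →ₗ[ℂ] ℂ :=
  LinearMap.mk₂'ₛₗ _ _ (fun x y => ⟪a x, b y⟫_ℂ)
    (fun x y z => by simp)
    (fun c x y => by simp [mul_comm])
    (fun x y z => by simp)
    (fun c x y => by simp)

@[simp]
theorem innerForm_apply (a b : M →ₗ[ℂ] H) (x y : M) : innerForm a b x y = ⟪a x, b y⟫_ℂ := rfl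

/-- A symmetric operator whose quadratic form is bounded by `ε` has norm at most `ε`. -/
theorem norm_apply_le_of_quadratic_bound {L : Submodule ℂ H} (S : L →ₗ[ℂ] L) {ε : ℝ} (hε : 0 < ε)
    (hsymm : ∀ x y : L, ⟪S x, y⟫_ℂ = ⟪x, S y⟫_ℂ)
    (hq : ∀ x : L, |(⟪x, S x⟫_ℂ).re| ≤ ε * ‖x‖ ^ 2) (x : L) : ‖S x‖ ≤ ε * ‖x‖ := by
  -- Polarization in the direction `Sx`: the forms at `x ± ε⁻¹Sx` differ by `4ε⁻¹‖Sx‖²`, while the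
  -- parallelogram law bounds the difference by `2ε(‖x‖² + ε⁻²‖Sx‖²)`. The factor `ε⁻¹` balances the
  -- two terms.
  have h1 := le_of_abs_le (hq (x + (ε⁻¹ : ℂ) • S x))
  have h2 := neg_le_of_abs_le (hq (x - (ε⁻¹ : ℂ) • S x))
  have h3 : ‖x + (ε⁻¹ : ℂ) • S x‖ ^ 2 + ‖x - (ε⁻¹ : ℂ) • S x‖ ^ 2 =
      2 * (‖x‖ ^ 2 + (ε⁻¹ * ‖S x‖) ^ 2) := by
    have := parallelogram_law_with_norm ℂ x ((ε⁻¹ : ℂ) • S x)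
    rw [norm_smul, norm_inv, Complex.norm_real, Real.norm_eq_abs, abs_of_pos hε] at this
    nlinarith [this]
  have h4 : (⟪x + (ε⁻¹ : ℂ) • S x, S (x + (ε⁻¹ : ℂ) • S x)⟫_ℂ).re
      - (⟪x - (ε⁻¹ : ℂ) • S x, S (x - (ε⁻¹ : ℂ) • S x)⟫_ℂ).re = 4 * ε⁻¹ * ‖S x‖ ^ 2 := by
    have h5 : ⟪x, S (S x)⟫_ℂ = ⟪S x, S x⟫_ℂ := (hsymm _ _).symm
    have h6 : ⟪S x, S x⟫_ℂ = ((‖S x‖ ^ 2 : ℝ) : ℂ) := by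
      rw [inner_self_eq_norm_sq_to_K]; push_cast; rfl
    simp only [map_add, map_sub, map_smul, inner_add_left, inner_add_right, inner_sub_left,
      inner_sub_right, inner_smul_left, inner_smul_right, h5, h6, ← Complex.ofReal_inv,
      Complex.conj_ofReal, Complex.add_re, Complex.sub_re, ← Complex.ofReal_mul,
      Complex.ofReal_re, Complex.re_ofReal_mul]
    ring
  have h7 : 4 * ε⁻¹ * ‖S x‖ ^ 2 ≤ ε * (2 * (‖x‖ ^ 2 + (ε⁻¹ * ‖S x‖) ^ 2)) := by
    rw [← h3, ← h4]; linarith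
  have h8 : ‖S x‖ ^ 2 ≤ (ε * ‖x‖) ^ 2 := by
    have h9 : ε * (2 * (‖x‖ ^ 2 + (ε⁻¹ * ‖S x‖) ^ 2)) =
      2 * ε * ‖x‖ ^ 2 + 2 * ε⁻¹ * ‖S x‖ ^ 2 := by field_simp
    have h10 : ε⁻¹ * ‖S x‖ ^ 2 ≤ ε * ‖x‖ ^ 2 := by nlinarith
    have h11 := mul_le_mul_of_nonneg_left h10 hε.le
    rw [← mul_assoc, mul_inv_cancel₀ hε.ne', one_mul] at h11
    nlinarith
  exact (sq_le_sq₀ (norm_nonneg _) (by positivity)).mp h8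

end Sesquilinear

/-! ### Calculus of projection-valued measures -/

namespace ProjectionValuedMeasure

variable {H : Type*} [NormedAddCommGroup H] [InnerProductSpace ℂ H] [CompleteSpace H]
  (E : ProjectionValuedMeasure H)

theorem scalarMeasure_eq (v : H) {B : Set ℝ} (hB : MeasurableSet B) :
    E.scalarMeasure v B = ENNReal.ofReal (‖E.proj B v‖ ^ 2) :=
  Measure.ofMeasurable_apply _ hB

theorem scalarMeasure_univ (v : H) : E.scalarMeasure v Set.univ = ENNReal.ofReal (‖v‖ ^ 2) := by
  rw [scalarMeasure_eq E v MeasurableSet.univ, E.proj_univ]; rfl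

instance (v : H) : IsFiniteMeasure (E.scalarMeasure v) :=
  ⟨by rw [scalarMeasure_univ]; exact ENNReal.ofReal_lt_top⟩

theorem proj_proj {B C : Set ℝ} (hB : MeasurableSet B) (hC : MeasurableSet C) (v : H) :
    E.proj B (E.proj C v) = E.proj (B ∩ C) v := by
  rw [E.proj_inter B C hB hC]; rfl

theorem proj_idem {B : Set ℝ} (hB : MeasurableSet B) (v : H) :
    E.proj B (E.proj B v) = E.proj B v := by
  rw [E.proj_proj hB hB, Set.inter_self]

theorem inner_proj_left {B : Set ℝ} (hB : MeasurableSet B) (v w : H) :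
    ⟪E.proj B v, w⟫_ℂ = ⟪v, E.proj B w⟫_ℂ := by
  have h2 : ContinuousLinearMap.adjoint (E.proj B) = E.proj B := (E.isStarProjection B hB).isSelfAdjoint
  rw [← ContinuousLinearMap.adjoint_inner_right, h2]

theorem proj_compl {B : Set ℝ} (hB : MeasurableSet B) (v : H) :
    E.proj Bᶜ v = v - E.proj B v := by
  have h1 : ∀ w, ‖E.proj B w‖ ^ 2 + ‖E.proj Bᶜ w‖ ^ 2 = ‖w‖ ^ 2 := by
    intro w
    have h := measure_add_measure_compl (μ := E.scalarMeasure w) hB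
    rw [scalarMeasure_eq _ _ hB, scalarMeasure_eq _ _ hB.compl, scalarMeasure_univ,
      ← ENNReal.ofReal_add (by positivity) (by positivity)] at h
    exact (ENNReal.ofReal_eq_ofReal_iff (by positivity) (by positivity)).mp h
  -- The remainder is killed by both projections, so the Pythagorean identity gives it norm zero.
  have h2 := h1 (v - E.proj B v - E.proj Bᶜ v)
  simp only [map_sub, E.proj_idem hB, E.proj_idem hB.compl, E.proj_proj hB hB.compl,
    E.proj_proj hB.compl hB, Set.inter_compl_self, Set.compl_inter_self, E.proj_empty, sub_self,
    sub_zero, norm_zero] at h2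
  have h3 : ‖v - E.proj B v - E.proj Bᶜ v‖ = 0 := by
    rw [← sq_eq_zero_iff, ← h2]; norm_num
  rw [norm_eq_zero, sub_eq_zero] at h3
  exact h3.symm

theorem scalarMeasure_proj {B : Set ℝ} (hB : MeasurableSet B) (v : H) :
    E.scalarMeasure (E.proj B v) = (E.scalarMeasure v).restrict B := by
  ext C hC
  rw [Measure.restrict_apply hC, scalarMeasure_eq _ _ hC, scalarMeasure_eq _ _ (hC.inter hB),
    E.proj_proj hC hB]

/-- Polarization on Borel sets; on the other sets both projections are zero by convention. -/
theorem ext_of_scalarMeasure {E F : ProjectionValuedMeasure H}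
    (h : ∀ v, E.scalarMeasure v = F.scalarMeasure v) : E = F := by
  ext1
  funext B
  by_cases hB : MeasurableSet B
  · refine (ContinuousLinearMap.ext_iff.mpr fun y => ext_inner_left ℂ fun x => ?_)
    have h1 := sesqForm_eq_zero_of_diag
      (innerForm LinearMap.id ((E.proj B - F.proj B : H →L[ℂ] H) : H →ₗ[ℂ] H)) (fun v => by
        have h2 := E.scalarMeasure_apply v hB
        have h3 := F.scalarMeasure_apply v hB
        rw [h] at h2
        simp [← h2, ← h3]) x y
    simpa [inner_sub_right, sub_eq_zero] using h1
  · rw [E.proj_of_not_measurable B hB, F.proj_of_not_measurable B hB]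

/-- At most one bounded operator is the integral of `φ`. -/
theorem IsIntegral.unique {φ : ℝ → ℂ} {S T : H →L[ℂ] H} (hS : E.IsIntegral φ S)
    (hT : E.IsIntegral φ T) : S = T := by
  refine (ContinuousLinearMap.ext_iff.mpr fun y => ext_inner_left ℂ fun x => ?_)
  have h1 := sesqForm_eq_zero_of_diag (innerForm LinearMap.id ((S - T : H →L[ℂ] H) : H →ₗ[ℂ] H))
    (fun v => by simp [hS v, hT v]) x y
  simpa [inner_sub_right, sub_eq_zero] using h1

theorem IsIntegral.integral_eq {φ : ℝ → ℂ} {T : H →L[ℂ] H} (hT : E.IsIntegral φ T) :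
    E.integral φ = T := by
  have h : ∃ T, E.IsIntegral φ T := ⟨T, hT⟩
  rw [ProjectionValuedMeasure.integral, dif_pos h]
  exact IsIntegral.unique E h.choose_spec hT

/-- Comparison of two projection-valued measures on intervals. -/
theorem scalarMeasure_eq_of_Icc_le {μ ν : Measure ℝ} [IsFiniteMeasure μ] [IsFiniteMeasure ν]
    (huniv : μ Set.univ = ν Set.univ)
    (h : ∀ a b η : ℝ, a < b → 0 < η → μ (Set.Icc a b) ≤ ν (Set.Ioo (a - η) (b + η))) : μ = ν := by
  obtain ⟨u, hu1, hu2, hu3⟩ := exists_seq_strictAnti_tendsto (0 : ℝ)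
  have hu0 : ∀ n, u n ≤ u 0 := fun n => hu1.antitone (Nat.zero_le n)
  have hlim : ∀ x y : ℝ, 0 < x → ∃ n : ℕ, 2 * u n < x ∧ y < n := by
    intro x y hx
    have h1 : ∀ᶠ n in atTop, 2 * u n < x := by
      have := hu3.const_mul 2
      rw [mul_zero] at this
      exact this.eventually (gt_mem_nhds hx)
    exact (h1.and (tendsto_natCast_atTop_atTop.eventually (eventually_gt_atTop y))).exists
  -- Exhaust `s` by closed intervals whose enlargements by `u n` stay in `s`, and use continuity
  -- from below.
  have key : ∀ s : Set ℝ, ∀ a b : ℕ → ℝ, Antitone a → Monotone b →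
      (∀ x ∈ s, ∃ n, x ∈ Set.Icc (a n) (b n)) → (∀ n, a n < b n) →
      (∀ n, Set.Ioo (a n - u n) (b n + u n) ⊆ s) → μ s ≤ ν s := by
    intro s a b ha hb hs hab hsub
    have hmono : Monotone (fun n => Set.Icc (a n) (b n)) :=
      fun m n hmn => Set.Icc_subset_Icc (ha hmn) (hb hmn)
    have hs' : s ⊆ ⋃ n, Set.Icc (a n) (b n) := fun x hx => Set.mem_iUnion.mpr (hs x hx)
    refine (measure_mono hs').trans ?_
    rw [hmono.measure_iUnion]
    exact iSup_le fun n => (h _ _ _ (hab n) (hu2 n)).trans (measure_mono (hsub n))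
  have hI : ∀ c : ℝ, μ (Set.Ioi c) ≤ ν (Set.Ioi c) := by
    intro c
    -- Enlarging by `u n` leaves the left end at `c + u n > c`; the term `2 * u 0` keeps the right
    -- end beyond the left end for every `n`.
    refine key _ (fun n => c + 2 * u n) (fun n => c + 2 * u 0 + (n + 1)) ?_ ?_ ?_ ?_ ?_
    · intro m n hmn
      have := hu1.antitone hmn
      linarith
    · intro m n hmn
      have : (m : ℝ) ≤ n := by exact_mod_cast hmn
      dsimp only; linarith
    · intro x hx
      obtain ⟨n, h1, h2⟩ := hlim (x - c) (x - c - 2 * u 0) (sub_pos.mpr hx)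
      exact ⟨n, by linarith, by linarith⟩
    · intro n
      have := hu0 n
      have : (0 : ℝ) ≤ n := n.cast_nonneg
      linarith
    · intro n x hx
      have := hu2 n
      have := hx.1
      simp only [Set.mem_Ioi]; linarith
  have hJ : ∀ c : ℝ, μ (Set.Iio c) ≤ ν (Set.Iio c) := by
    intro c
    refine key _ (fun n => c - 2 * u 0 - (n + 1)) (fun n => c - 2 * u n) ?_ ?_ ?_ ?_ ?_
    · intro m n hmn
      have : (m : ℝ) ≤ n := by exact_mod_cast hmn
      dsimp only; linarith
    · intro m n hmn
      have := hu1.antitone hmn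
      linarith
    · intro x hx
      obtain ⟨n, h1, h2⟩ := hlim (c - x) (c - x - 2 * u 0) (sub_pos.mpr hx)
      exact ⟨n, by linarith, by linarith⟩
    · intro n
      have := hu0 n
      have : (0 : ℝ) ≤ n := n.cast_nonneg
      linarith
    · intro n x hx
      have := hu2 n
      have := hx.2
      simp only [Set.mem_Iio]; linarith
  -- Since the total masses agree, complements reverse the inequality; this gives equality on
  -- half-lines.
  have hK : ∀ c : ℝ, ν (Set.Ici c) ≤ μ (Set.Ici c) := by
    intro c
    rw [← Set.compl_Iio, measure_compl measurableSet_Iio (measure_ne_top _ _),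
      measure_compl measurableSet_Iio (measure_ne_top _ _), huniv]
    exact tsub_le_tsub_left (hJ c) _
  have hL : ∀ c : ℝ, ν (Set.Ioi c) ≤ μ (Set.Ioi c) := by
    intro c
    have hmono : Monotone (fun n => Set.Ici (c + u n)) := fun m n hmn =>
      Set.Ici_subset_Ici.mpr (by have := hu1.antitone hmn; linarith)
    have hs : Set.Ioi c ⊆ ⋃ n, Set.Ici (c + u n) := fun x hx => by
      obtain ⟨n, h1, -⟩ := hlim (x - c) 0 (sub_pos.mpr hx)
      refine Set.mem_iUnion.mpr ⟨n, ?_⟩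
      have := hu2 n
      simp only [Set.mem_Ici]; linarith
    refine (measure_mono hs).trans ?_
    rw [hmono.measure_iUnion]
    refine iSup_le fun n => (hK _).trans (measure_mono fun x hx => ?_)
    have := hu2 n
    simp only [Set.mem_Ici] at hx
    simp only [Set.mem_Ioi]; linarith
  refine Measure.ext_of_Iic _ _ fun c => ?_
  rw [← Set.compl_Ioi, measure_compl measurableSet_Ioi (measure_ne_top _ _),
    measure_compl measurableSet_Ioi (measure_ne_top _ _), huniv, le_antisymm (hI c) (hL c)]

/-! ### Spectral measures of symmetric operators -/

section Symmetric

variable {E} {T : H →ₗ.[ℂ] H}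

theorem IsSpectralMeasureOf.proj_mem (hE : E.IsSpectralMeasureOf T) {B : Set ℝ}
    (hB : MeasurableSet B) {v : H} (hv : v ∈ T.domain) : E.proj B v ∈ T.domain := by
  rw [hE.1, E.scalarMeasure_proj hB]
  exact ((hE.1 v).mp hv).mono_measure Measure.restrict_le_self

theorem IsSpectralMeasureOf.proj_Icc_mem (hE : E.IsSpectralMeasureOf T) (a b : ℝ) (v : H) :
    E.proj (Set.Icc a b) v ∈ T.domain := by
  rw [hE.1, E.scalarMeasure_proj measurableSet_Icc]
  exact ContinuousOn.integrableOn_compact isCompact_Icc (by fun_prop)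

/-- The compression of the domain of `T` by a spectral projection. -/
def IsSpectralMeasureOf.projDomain (hE : E.IsSpectralMeasureOf T) {B : Set ℝ}
    (hB : MeasurableSet B) : T.domain →ₗ[ℂ] T.domain :=
  ((E.proj B : H →ₗ[ℂ] H) ∘ₗ T.domain.subtype).codRestrict T.domain
    fun v => hE.proj_mem hB v.2

theorem IsSpectralMeasureOf.integrable_id (hE : E.IsSpectralMeasureOf T) {v : H}
    (hv : v ∈ T.domain) : Integrable (fun l : ℝ => l) (E.scalarMeasure v) := by
  have h := (hE.1 v).mp hv
  refine (h.add (integrable_const (1 : ℝ))).mono' (by fun_prop) (ae_of_all _ fun l => ?_)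
  simp only [Pi.add_apply, Real.norm_eq_abs]
  rw [abs_le]
  constructor <;> nlinarith [sq_nonneg (l + 1), sq_nonneg (l - 1)]

/-- The range of a spectral projection of `T` is invariant under `T`. -/
theorem IsSpectralMeasureOf.proj_apply (hE : E.IsSpectralMeasureOf T)
    (hT : Dense (T.domain : Set H)) {B : Set ℝ} (hB : MeasurableSet B) (v : T.domain)
    (hv : E.proj B v = v) : E.proj B (T v) = T v := by
  let P := hE.projDomain hB
  let Q := hE.projDomain hB.compl
  have hP : ∀ w : T.domain, ((P w : T.domain) : H) = E.proj B w := fun _ => rfl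
  have hQ : ∀ w : T.domain, ((Q w : T.domain) : H) = E.proj Bᶜ w := fun _ => rfl
  -- The form `⟪x, Ty⟫ - ⟪Px, TPy⟫ - ⟪Qx, TQy⟫` vanishes on the diagonal, because the scalar measure
  -- splits into its parts on `B` and on the complement.
  have h1 := sesqForm_eq_zero_of_diag
    (innerForm T.domain.subtype T.toFun - innerForm (T.domain.subtype ∘ₗ P) (T.toFun ∘ₗ P)
      - innerForm (T.domain.subtype ∘ₗ Q) (T.toFun ∘ₗ Q)) (fun w => by
    have h2 := hE.2 w
    have h3 := hE.2 (P w)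
    have h4 := hE.2 (Q w)
    rw [hP, E.scalarMeasure_proj hB, ← hP] at h3
    rw [hQ, E.scalarMeasure_proj hB.compl, ← hQ] at h4
    have h5 := integral_add_compl hB (hE.integrable_id w.2)
    simp only [LinearMap.sub_apply, innerForm_apply, LinearMap.comp_apply, Submodule.subtype_apply,
      LinearPMap.toFun_eq_coe]
    rw [h2, h3, h4, ← h5]
    push_cast
    ring)
  have hPv : P v = v := Subtype.ext hv
  have hQv : Q v = 0 := Subtype.ext (by
    rw [hQ, E.proj_compl hB, hv, sub_self]; rfl)
  -- With `Pv = v` and `Qv = 0` the polarized identity reads `⟪w, Tv⟫ = ⟪Pw, Tv⟫` for `w` in the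
  -- dense domain.
  have h2 : T v - E.proj B (T v) = 0 := by
    refine hT.eq_zero_of_inner_right ℂ fun w hw => ?_
    have h3 := h1 ⟨w, hw⟩ v
    simp only [LinearMap.sub_apply, innerForm_apply, LinearMap.comp_apply, Submodule.subtype_apply,
      LinearPMap.toFun_eq_coe, hPv, hQv, LinearPMap.map_zero, inner_zero_right, sub_zero, hP] at h3
    rw [inner_sub_right, ← E.inner_proj_left hB, h3]
  exact (sub_eq_zero.mp h2).symm

/-- On the range of the spectral projection of an interval, `T` is close to the midpoint. -/
theorem IsSpectralMeasureOf.norm_sub_midpoint_le (hE : E.IsSpectralMeasureOf T)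
    (hT : Dense (T.domain : Set H))
    (hsymm : ∀ v w : T.domain, ⟪T v, (w : H)⟫_ℂ = ⟪(v : H), T w⟫_ℂ) {c ε : ℝ} (hε : 0 < ε)
    (v : T.domain) (hv : E.proj (Set.Icc (c - ε) (c + ε)) v = v) :
    ‖T v - (c : ℂ) • (v : H)‖ ≤ ε * ‖(v : H)‖ := by
  have hI : MeasurableSet (Set.Icc (c - ε) (c + ε)) := measurableSet_Icc
  -- `L` is the range of the projection. It lies in the domain and is invariant under `T`, so `T -
  -- c` restricts to an everywhere defined symmetric operator on `L`, which is controlled by its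
  -- quadratic form.
  let L : Submodule ℂ H :=
    LinearMap.eqLocus (E.proj (Set.Icc (c - ε) (c + ε)) : H →ₗ[ℂ] H) LinearMap.id
  have hL : L ≤ T.domain := fun w hw => by
    have : E.proj (Set.Icc (c - ε) (c + ε)) w = w := hw
    rw [← this]
    exact hE.proj_Icc_mem _ _ _
  let S : L →ₗ[ℂ] L := LinearMap.codRestrict L
    (T.toFun ∘ₗ Submodule.inclusion hL - (c : ℂ) • L.subtype) fun w => by
      have hw : E.proj (Set.Icc (c - ε) (c + ε)) (w : H) = w := w.2
      have := hE.proj_apply hT hI (Submodule.inclusion hL w) hw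
      change E.proj _ (T (Submodule.inclusion hL w) - (c : ℂ) • (w : H)) =
        (T (Submodule.inclusion hL w) - (c : ℂ) • (w : H))
      rw [map_sub, map_smul, this, hw]
  have hS : ∀ w : L, ((S w : L) : H) = T (Submodule.inclusion hL w) - (c : ℂ) • (w : H) :=
    fun _ => rfl
  refine norm_apply_le_of_quadratic_bound S hε ?_ ?_ ⟨v, hv⟩
  · intro x y
    rw [Submodule.coe_inner, Submodule.coe_inner, hS, hS, inner_sub_left, inner_sub_right,
      inner_smul_left, inner_smul_right, Complex.conj_ofReal]
    congr 1
    exact hsymm (Submodule.inclusion hL x) (Submodule.inclusion hL y)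
  · intro x
    have hx : E.proj (Set.Icc (c - ε) (c + ε)) (x : H) = x := x.2
    have h1 := hE.2 (Submodule.inclusion hL x)
    rw [Submodule.coe_inclusion] at h1
    have h2 : ⟪(x : H), (x : H)⟫_ℂ = ((∫ _, 1 ∂(E.scalarMeasure (x : H)) : ℝ) : ℂ) := by
      rw [inner_self_eq_norm_sq_to_K, integral_const, Measure.real, scalarMeasure_univ,
        ENNReal.toReal_ofReal (by positivity)]
      simp
    have h3 : ⟪x, S x⟫_ℂ = ((∫ l, (l - c) ∂(E.scalarMeasure (x : H)) : ℝ) : ℂ) := by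
      rw [Submodule.coe_inner, hS, inner_sub_right, inner_smul_right, h1, h2,
        integral_sub (hE.integrable_id (hL x.2)) (integrable_const _), integral_const,
        integral_const]
      push_cast
      simp [mul_comm]
    -- The scalar measure of a vector in `L` is carried by the interval.
    have h4 : ∀ᵐ l ∂(E.scalarMeasure (x : H)), ‖l - c‖ ≤ ε := by
      rw [← hx, E.scalarMeasure_proj hI]
      refine (ae_restrict_mem hI).mono fun l hl => ?_
      rw [Real.norm_eq_abs, abs_le]
      constructor <;> linarith [hl.1, hl.2]
    have h5 := norm_integral_le_of_norm_le_const h4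
    rw [Measure.real, scalarMeasure_univ, ENNReal.toReal_ofReal (by positivity)] at h5
    rw [h3, Complex.ofReal_re, ← Real.norm_eq_abs]
    exact h5

theorem norm_proj_le {B : Set ℝ} (hB : MeasurableSet B) (v : H) : ‖E.proj B v‖ ≤ ‖v‖ := by
  have h : E.scalarMeasure v B ≤ E.scalarMeasure v Set.univ := measure_mono (Set.subset_univ _)
  rw [scalarMeasure_eq _ _ hB, scalarMeasure_univ, ENNReal.ofReal_le_ofReal_iff (by positivity)] at h
  exact (sq_le_sq₀ (norm_nonneg _) (norm_nonneg _)).mp h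

/-- A spectral measure `E` of a symmetric operator `T` is equal to every projection-valued measure
`F` whose projections on complements of intervals bound `T` from below. -/
theorem IsSpectralMeasureOf.eq_of_lower_bound (hE : E.IsSpectralMeasureOf T)
    (hT : Dense (T.domain : Set H))
    (hsymm : ∀ v w : T.domain, ⟪T v, (w : H)⟫_ℂ = ⟪(v : H), T w⟫_ℂ)
    (F : ProjectionValuedMeasure H)
    (hF : ∀ c δ : ℝ, 0 < δ → ∀ w : T.domain, δ * ‖F.proj (Set.Ioo (c - δ) (c + δ))ᶜ w‖ ≤
      ‖F.proj (Set.Ioo (c - δ) (c + δ))ᶜ (T w - (c : ℂ) • (w : H))‖) : E = F := by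
  -- The range of `E` on a closed interval lies in that of `F` on every larger concentric open one.
  have key : ∀ c ε δ : ℝ, 0 < ε → ε < δ → ∀ u : H, E.proj (Set.Icc (c - ε) (c + ε)) u = u →
      F.proj (Set.Ioo (c - δ) (c + δ)) u = u := by
    intro c ε δ hε hδ u hu
    have hJ : MeasurableSet (Set.Ioo (c - δ) (c + δ)) := measurableSet_Ioo
    have h0 : 0 < δ := hε.trans hδ
    -- The witness is `w = (T - c)^k u`: it grows at most like `ε^k`, while its part outside the
    -- larger interval grows at least like `δ^k`.
    have h1 : ∀ k : ℕ, ∃ w : H, E.proj (Set.Icc (c - ε) (c + ε)) w = w ∧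
        δ ^ k * ‖F.proj (Set.Ioo (c - δ) (c + δ))ᶜ u‖ ≤
          ‖F.proj (Set.Ioo (c - δ) (c + δ))ᶜ w‖ ∧ ‖w‖ ≤ ε ^ k * ‖u‖ := by
      intro k
      induction k with
      | zero => exact ⟨u, hu, by simp, by simp⟩
      | succ k ih =>
        obtain ⟨w, hw1, hw2, hw3⟩ := ih
        have hw : w ∈ T.domain := by
          rw [← hw1]
          exact hE.proj_Icc_mem _ _ _
        refine ⟨T ⟨w, hw⟩ - (c : ℂ) • w, ?_, ?_, ?_⟩
        · rw [map_sub, map_smul, hE.proj_apply hT measurableSet_Icc ⟨w, hw⟩ hw1, hw1]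
        · refine le_trans ?_ (hF c δ h0 ⟨w, hw⟩)
          rw [pow_succ', mul_assoc]
          exact mul_le_mul_of_nonneg_left hw2 h0.le
        · refine (hE.norm_sub_midpoint_le hT hsymm hε ⟨w, hw⟩ hw1).trans ?_
          rw [pow_succ', mul_assoc]
          exact mul_le_mul_of_nonneg_left hw3 hε.le
    have h2 : ∀ k : ℕ, ‖F.proj (Set.Ioo (c - δ) (c + δ))ᶜ u‖ ≤ (ε / δ) ^ k * ‖u‖ := by
      intro k
      obtain ⟨w, -, hw2, hw3⟩ := h1 k
      have h3 := (hw2.trans (norm_proj_le (E := F) hJ.compl w)).trans hw3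
      rw [div_pow, div_mul_eq_mul_div, le_div_iff₀ (by positivity)]
      linarith
    have h3 : Tendsto (fun k : ℕ => (ε / δ) ^ k * ‖u‖) atTop (𝓝 0) := by
      have := (tendsto_pow_atTop_nhds_zero_of_lt_one (by positivity)
        ((div_lt_one h0).mpr hδ)).mul_const ‖u‖
      rwa [zero_mul] at this
    have h4 : ‖F.proj (Set.Ioo (c - δ) (c + δ))ᶜ u‖ ≤ 0 := ge_of_tendsto' h3 h2
    have h5 := norm_le_zero_iff.mp h4
    rw [F.proj_compl hJ, sub_eq_zero] at h5
    exact h5.symm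
  refine ext_of_scalarMeasure fun v => scalarMeasure_eq_of_Icc_le ?_ fun a b η hab hη => ?_
  · rw [scalarMeasure_univ, scalarMeasure_univ]
  · have ha : (a + b) / 2 - (b - a) / 2 = a := by ring
    have hb : (a + b) / 2 + (b - a) / 2 = b := by ring
    have ha' : (a + b) / 2 - ((b - a) / 2 + η) = a - η := by ring
    have hb' : (a + b) / 2 + ((b - a) / 2 + η) = b + η := by ring
    have h1 := key ((a + b) / 2) ((b - a) / 2) ((b - a) / 2 + η) (by linarith) (by linarith)
      (E.proj (Set.Icc a b) v)
    rw [ha, hb, ha', hb'] at h1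
    have h2 := h1 (E.proj_idem measurableSet_Icc v)
    rw [scalarMeasure_eq _ _ measurableSet_Icc, scalarMeasure_eq _ _ measurableSet_Ioo]
    refine ENNReal.ofReal_le_ofReal ((sq_le_sq₀ (norm_nonneg _) (norm_nonneg _)).mpr ?_)
    -- As `F` fixes `E v`, one has `‖E v‖² = ⟪v, E v⟫ = ⟪F v, E v⟫`; then Cauchy–Schwarz.
    have h3 : ‖E.proj (Set.Icc a b) v‖ ^ 2 ≤
        ‖F.proj (Set.Ioo (a - η) (b + η)) v‖ * ‖E.proj (Set.Icc a b) v‖ := by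
      have h4 := E.inner_eq v (measurableSet_Icc (a := a) (b := b))
      rw [← h2, ← F.inner_proj_left measurableSet_Ioo, h2] at h4
      have h5 := norm_inner_le_norm (𝕜 := ℂ) (F.proj (Set.Ioo (a - η) (b + η)) v)
        (E.proj (Set.Icc a b) v)
      rw [h4, Complex.norm_real, Real.norm_eq_abs, abs_of_nonneg (by positivity)] at h5
      exact h5
    rcases (norm_nonneg (E.proj (Set.Icc a b) v)).eq_or_lt with h6 | h6
    · rw [← h6]; exact norm_nonneg _
    · rw [sq] at h3
      exact le_of_mul_le_mul_right h3 h6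

end Symmetric

end ProjectionValuedMeasure

/-! ### Multiplication operators -/

section Multiplication

variable {H K X : Type*} [NormedAddCommGroup H] [InnerProductSpace ℂ H]
  [NormedAddCommGroup K] [InnerProductSpace ℂ K] [MeasurableSpace X] {ν : Measure X}
  (W : H ≃ₗᵢ[ℂ] Lp K 2 ν)

theorem ext_of_ae {v w : H} (h : W v =ᵐ[ν] W w) : v = w :=
  W.injective (Lp.ext h)

theorem memLp_map (v : H) : MemLp (W v) 2 ν := Lp.memLp _

theorem inner_eq_integral (v w : H) : ⟪v, w⟫_ℂ = ∫ x, ⟪W v x, W w x⟫_ℂ ∂ν := by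
  rw [← W.inner_map_map, L2.inner_def]

theorem memLp_smul_of_bound {φ : X → ℂ} (hφ : Measurable φ) (hb : ∀ x, ‖φ x‖ ≤ 1) (u : Lp K 2 ν) :
    MemLp (fun x => φ x • u x) 2 ν := by
  refine (Lp.memLp u).mono (hφ.aestronglyMeasurable.smul (Lp.aestronglyMeasurable u))
    (ae_of_all _ fun x => ?_)
  rw [norm_smul]
  exact mul_le_of_le_one_left (norm_nonneg _) (hb x)

/-- Multiplication by a function bounded by `1`, transported by `W`. -/
def mulOp {φ : X → ℂ} (hφ : Measurable φ) (hb : ∀ x, ‖φ x‖ ≤ 1) : H →L[ℂ] H :=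
  (W.symm.toLinearIsometry.toContinuousLinearMap ∘L
    (LinearMap.mkContinuous
      { toFun := fun u : Lp K 2 ν => (memLp_smul_of_bound hφ hb u).toLp
        map_add' := fun u w => by
          refine Lp.ext ?_
          filter_upwards [(memLp_smul_of_bound hφ hb (u + w)).coeFn_toLp,
            (memLp_smul_of_bound hφ hb u).coeFn_toLp, (memLp_smul_of_bound hφ hb w).coeFn_toLp,
            Lp.coeFn_add u w, Lp.coeFn_add (memLp_smul_of_bound hφ hb u).toLp
              (memLp_smul_of_bound hφ hb w).toLp] with x h1 h2 h3 h4 h5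
          rw [h1, h5, Pi.add_apply, h2, h3, h4, Pi.add_apply, smul_add]
        map_smul' := fun c u => by
          refine Lp.ext ?_
          filter_upwards [(memLp_smul_of_bound hφ hb (c • u)).coeFn_toLp,
            (memLp_smul_of_bound hφ hb u).coeFn_toLp,
            Lp.coeFn_smul c u, Lp.coeFn_smul c (memLp_smul_of_bound hφ hb u).toLp]
            with x h1 h2 h3 h4
          rw [RingHom.id_apply, h1, h4, Pi.smul_apply, h2, h3, Pi.smul_apply, smul_comm] }
      1 (fun u => by
        rw [one_mul]
        refine Lp.norm_le_norm_of_ae_le ?_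
        filter_upwards [(memLp_smul_of_bound hφ hb u).coeFn_toLp] with x hx
        change ‖(memLp_smul_of_bound hφ hb u).toLp _ x‖ ≤ _
        rw [hx, norm_smul]
        exact mul_le_of_le_one_left (norm_nonneg _) (hb x)))) ∘L
    W.toLinearIsometry.toContinuousLinearMap

theorem map_mulOp {φ : X → ℂ} (hφ : Measurable φ) (hb : ∀ x, ‖φ x‖ ≤ 1) (v : H) :
    W (mulOp W hφ hb v) =ᵐ[ν] fun x => φ x • W v x := by
  have h : W (mulOp W hφ hb v) = (memLp_smul_of_bound hφ hb (W v)).toLp :=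
    W.apply_symm_apply _
  rw [h]
  exact (memLp_smul_of_bound hφ hb (W v)).coeFn_toLp

theorem map_add_ae (v w : H) : W (v + w) =ᵐ[ν] fun x => W v x + W w x := by
  rw [map_add]; exact Lp.coeFn_add _ _

theorem map_sub_ae (v w : H) : W (v - w) =ᵐ[ν] fun x => W v x - W w x := by
  rw [map_sub]; exact Lp.coeFn_sub _ _

theorem map_smul_ae (c : ℂ) (v : H) : W (c • v) =ᵐ[ν] fun x => c • W v x := by
  rw [map_smul]; exact Lp.coeFn_smul _ _

theorem map_zero_ae : W (0 : H) =ᵐ[ν] fun _ => 0 := by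
  rw [map_zero]; exact Lp.coeFn_zero _ _ _

theorem map_sum_ae {ι : Type*} (s : Finset ι) (v : ι → H) :
    W (∑ i ∈ s, v i) =ᵐ[ν] fun x => ∑ i ∈ s, W (v i) x := by
  classical
  induction s using Finset.induction_on with
  | empty => simpa using map_zero_ae W
  | insert i s hi ih =>
    rw [Finset.sum_insert hi]
    filter_upwards [map_add_ae W (v i) (∑ j ∈ s, v j), ih] with x h1 h2
    rw [h1, h2, Finset.sum_insert hi]

theorem norm_le_of_map_le {v w : H} (h : ∀ᵐ x ∂ν, ‖W v x‖ ≤ ‖W w x‖) : ‖v‖ ≤ ‖w‖ := by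
  rw [← W.norm_map v, ← W.norm_map w]
  exact Lp.norm_le_norm_of_ae_le h

/-- Multiplication by the indicator function of `s`. -/
def indOp {s : Set X} (hs : MeasurableSet s) : H →L[ℂ] H :=
  mulOp W (φ := s.indicator 1) (measurable_one.indicator hs) fun x => by
    by_cases hx : x ∈ s <;> simp [hx]

theorem map_indOp {s : Set X} (hs : MeasurableSet s) (v : H) :
    W (indOp W hs v) =ᵐ[ν] s.indicator (W v) := by
  filter_upwards [map_mulOp W (φ := s.indicator 1) (measurable_one.indicator hs) (fun x => by
    by_cases hx : x ∈ s <;> simp [hx]) v] with x hx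
  rw [indOp, hx]
  by_cases h : x ∈ s <;> simp [h]

/-- The distribution of `l` with respect to the density `‖W v‖²`. -/
def distMeasure (l : X → ℝ) (v : H) : Measure ℝ :=
  (ν.withDensity fun x => ((‖W v x‖₊ ^ 2 : NNReal) : ENNReal)).map l

variable {l : X → ℝ} (hl : Measurable l)

theorem measurable_nnnorm_map (v : H) : Measurable fun x => ‖W v x‖₊ ^ 2 :=
  ((Lp.stronglyMeasurable (W v)).nnnorm.measurable).pow_const 2

theorem enorm_sq_eq_lintegral (v : H) :
    ENNReal.ofReal (‖v‖ ^ 2) = ∫⁻ x, ((‖W v x‖₊ ^ 2 : NNReal) : ENNReal) ∂ν := by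
  have h1 : ‖v‖ ^ 2 = ∫ x, ‖W v x‖ ^ 2 ∂ν := by
    have h2 := inner_eq_integral W v v
    simp only [inner_self_eq_norm_sq_to_K] at h2
    have h3 : ((‖v‖ ^ 2 : ℝ) : ℂ) = ((∫ x, ‖W v x‖ ^ 2 ∂ν : ℝ) : ℂ) := by
      rw [← integral_complex_ofReal]
      push_cast
      exact h2
    exact_mod_cast h3
  rw [h1, ofReal_integral_eq_lintegral_ofReal ((memLp_map W v).integrable_norm_pow (by norm_num))
    (ae_of_all _ fun x => by positivity)]
  refine lintegral_congr fun x => ?_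
  rw [← ENNReal.ofReal_coe_nnreal]
  simp

include hl in
theorem distMeasure_apply (v : H) {B : Set ℝ} (hB : MeasurableSet B) :
    distMeasure W l v B = ENNReal.ofReal (‖indOp W (hl hB) v‖ ^ 2) := by
  rw [distMeasure, Measure.map_apply hl hB, withDensity_apply _ (hl hB), enorm_sq_eq_lintegral W,
    ← lintegral_indicator (hl hB)]
  refine lintegral_congr_ae ?_
  filter_upwards [map_indOp W (hl hB) v] with x hx
  rw [hx]
  by_cases h : x ∈ l ⁻¹' B <;> simp [h]

include hl in
theorem isFiniteMeasure_distMeasure (v : H) : IsFiniteMeasure (distMeasure W l v) :=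
  ⟨by rw [distMeasure_apply W hl v MeasurableSet.univ]; exact ENNReal.ofReal_lt_top⟩

include hl in
theorem distMeasure_real (v : H) {B : Set ℝ} (hB : MeasurableSet B) :
    (distMeasure W l v).real B = ‖indOp W (hl hB) v‖ ^ 2 := by
  rw [Measure.real, distMeasure_apply W hl v hB, ENNReal.toReal_ofReal (by positivity)]

include hl in
theorem integrable_distMeasure_iff {F : Type*} [NormedAddCommGroup F] [NormedSpace ℝ F] {g : ℝ → F}
    (hg : StronglyMeasurable g) (v : H) :
    Integrable g (distMeasure W l v) ↔ Integrable (fun x => ‖W v x‖ ^ 2 • g (l x)) ν := by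
  rw [distMeasure, integrable_map_measure hg.aestronglyMeasurable hl.aemeasurable,
    integrable_withDensity_iff_integrable_smul (measurable_nnnorm_map W v)]
  rfl

include hl in
theorem integral_distMeasure {F : Type*} [NormedAddCommGroup F] [NormedSpace ℝ F] {g : ℝ → F}
    (hg : StronglyMeasurable g) (v : H) :
    ∫ y, g y ∂(distMeasure W l v) = ∫ x, ‖W v x‖ ^ 2 • g (l x) ∂ν := by
  rw [distMeasure, integral_map hl.aemeasurable hg.aestronglyMeasurable,
    integral_withDensity_eq_integral_smul (measurable_nnnorm_map W v)]
  rfl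

variable [CompleteSpace H]

/-- The projection-valued measure of multiplication by `l`. -/
def mulPVM : ProjectionValuedMeasure H where
  proj B := open Classical in if hB : MeasurableSet B then indOp W (hl hB) else 0
  proj_of_not_measurable B hB := dif_neg hB
  isStarProjection B hB := by
    rw [dif_pos hB]
    constructor
    · refine ContinuousLinearMap.ext fun v => ext_of_ae W ?_
      filter_upwards [map_indOp W (hl hB) (indOp W (hl hB) v), map_indOp W (hl hB) v] with x h1 h2
      change W (indOp W (hl hB) (indOp W (hl hB) v)) x = _
      rw [h1]
      by_cases h : x ∈ l ⁻¹' B <;> simp [h2, h]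
    · rw [ContinuousLinearMap.isSelfAdjoint_iff_isSymmetric]
      intro v w
      change ⟪indOp W (hl hB) v, w⟫_ℂ = ⟪v, indOp W (hl hB) w⟫_ℂ
      rw [inner_eq_integral W, inner_eq_integral W]
      refine integral_congr_ae ?_
      filter_upwards [map_indOp W (hl hB) v, map_indOp W (hl hB) w] with x h1 h2
      rw [h1, h2]
      by_cases h : x ∈ l ⁻¹' B <;> simp [h]
  proj_univ := by
    rw [dif_pos MeasurableSet.univ]
    refine ContinuousLinearMap.ext fun v => ext_of_ae W ?_
    filter_upwards [map_indOp W (hl MeasurableSet.univ) v] with x h1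
    rw [h1]
    simp
  proj_inter B C hB hC := by
    rw [dif_pos hB, dif_pos hC, dif_pos (hB.inter hC)]
    refine ContinuousLinearMap.ext fun v => ext_of_ae W ?_
    filter_upwards [map_indOp W (hl hB) (indOp W (hl hC) v), map_indOp W (hl hC) v,
      map_indOp W (hl (hB.inter hC)) v] with x h1 h2 h3
    change _ = W (indOp W (hl hB) (indOp W (hl hC) v)) x
    rw [h1, h3, Set.preimage_inter, ← Set.indicator_indicator]
    by_cases h : x ∈ l ⁻¹' B <;> simp [h, h2]
  hasSum_proj B hB hd v := by
    have hU := MeasurableSet.iUnion hB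
    simp only [dif_pos hU, dif_pos (hB _)]
    have := isFiniteMeasure_distMeasure W hl v
    set m := distMeasure W l v with hm
    -- The error of a partial sum is multiplication by the indicator of what is left of the union,
    -- so its squared norm is the missing mass of the finite measure `m`.
    have h1 : ∀ s : Finset ℕ, ‖(∑ n ∈ s, indOp W (hl (hB n)) v) - indOp W (hl hU) v‖ ^ 2 =
        m.real (⋃ n, B n) - ∑ n ∈ s, m.real (B n) := by
      intro s
      have hs : MeasurableSet (⋃ n ∈ s, B n) := s.measurableSet_biUnion fun n _ => hB n
      have h2 : (∑ n ∈ s, indOp W (hl (hB n)) v) - indOp W (hl hU) v =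
          -indOp W (hl (hU.diff hs)) v := by
        rw [← neg_sub, neg_inj]
        refine ext_of_ae W ?_
        have h3 := ae_all_iff.mpr fun n => map_indOp W (hl (hB n)) v
        filter_upwards [map_indOp W (hl hU) v, map_indOp W (hl (hU.diff hs)) v, h3,
          map_sum_ae W s (fun n => indOp W (hl (hB n)) v),
          map_sub_ae W (indOp W (hl hU) v) (∑ n ∈ s, indOp W (hl (hB n)) v)]
          with x k1 k2 k3 k4 k5
        rw [k5, k4, k1, k2]
        simp only [k3]
        by_cases hx : ∃ n ∈ s, l x ∈ B n
        · obtain ⟨n, hn, hxn⟩ := hx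
          have h4 : ∑ k ∈ s, (l ⁻¹' B k).indicator (W v) x = W v x := by
            rw [Finset.sum_eq_single_of_mem n hn fun k _ hk => ?_,
              Set.indicator_of_mem (show x ∈ l ⁻¹' B n from hxn)]
            refine Set.indicator_of_notMem (fun hxk => ?_) _
            exact Set.disjoint_left.mp (hd hk) hxk hxn
          have h5 : x ∈ l ⁻¹' ⋃ n, B n := Set.mem_iUnion.mpr ⟨n, hxn⟩
          have h6 : x ∉ l ⁻¹' ((⋃ n, B n) \ ⋃ n ∈ s, B n) := fun h =>
            h.2 (Set.mem_biUnion hn hxn)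
          rw [h4, Set.indicator_of_mem h5, Set.indicator_of_notMem h6, sub_self]
        · push Not at hx
          have h4 : ∑ k ∈ s, (l ⁻¹' B k).indicator (W v) x = 0 :=
            Finset.sum_eq_zero fun k hk => Set.indicator_of_notMem (show x ∉ l ⁻¹' B k from hx k hk) _
          rw [h4, sub_zero]
          by_cases h5 : x ∈ l ⁻¹' ⋃ n, B n
          · have h6 : x ∈ l ⁻¹' ((⋃ n, B n) \ ⋃ n ∈ s, B n) := by
              refine ⟨h5, fun h => ?_⟩
              obtain ⟨n, hn, hxn⟩ := Set.mem_iUnion₂.mp h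
              exact hx n hn hxn
            rw [Set.indicator_of_mem h5, Set.indicator_of_mem h6]
          · rw [Set.indicator_of_notMem h5, Set.indicator_of_notMem fun h => h5 h.1]
      rw [h2, norm_neg, ← distMeasure_real W hl v (hU.diff hs),
        measureReal_sdiff (Set.iUnion₂_subset fun n _ => Set.subset_iUnion B n) hs,
        measureReal_biUnion_finset (fun i _ j _ hij => hd hij) fun n _ => hB n]
    have h2 : HasSum (fun n => m.real (B n)) (m.real (⋃ n, B n)) := by
      have h3 : ∑' n, m (B n) ≠ ⊤ := by
        rw [← measure_iUnion hd hB]; exact measure_ne_top _ _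
      rw [measureReal_def, measure_iUnion hd hB, ENNReal.tsum_toReal_eq fun n => measure_ne_top _ _]
      exact ENNReal.hasSum_toReal h3
    have h3 : Tendsto (fun s : Finset ℕ => m.real (⋃ n, B n) - ∑ n ∈ s, m.real (B n)) atTop
        (𝓝 0) := by
      have : Tendsto (fun s : Finset ℕ => ∑ n ∈ s, m.real (B n)) atTop (𝓝 (m.real (⋃ n, B n))) :=
        h2
      simpa using this.const_sub (m.real (⋃ n, B n))
    simp only [← h1] at h3
    change Tendsto (fun s : Finset ℕ => ∑ n ∈ s, indOp W (hl (hB n)) v) atTop _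
    rw [tendsto_iff_norm_sub_tendsto_zero]
    have h4 := h3.sqrt
    simpa using h4

theorem mulPVM_proj {B : Set ℝ} (hB : MeasurableSet B) :
    (mulPVM W hl).proj B = indOp W (hl hB) := dif_pos hB

theorem scalarMeasure_mulPVM (v : H) : (mulPVM W hl).scalarMeasure v = distMeasure W l v := by
  ext B hB
  rw [ProjectionValuedMeasure.scalarMeasure_eq _ _ hB, mulPVM_proj W hl hB,
    distMeasure_apply W hl v hB]

/-! ### The skew-adjoint operator of multiplication by `i l` -/

end Multiplication

/-! ### The skew-adjoint operator of multiplication by `i l` -/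

section SkewMultiplication

variable {H K X : Type*} [NormedAddCommGroup H] [InnerProductSpace ℂ H]
  [NormedAddCommGroup K] [InnerProductSpace ℂ K] [MeasurableSpace X] {ν : Measure X}
  (W : H ≃ₗᵢ[ℂ] Lp K 2 ν) (l : X → ℝ)

/-- The maximal domain of multiplication by `i l`, transported by `W`. -/
def mulSkewDomain : Submodule ℂ H where
  carrier := {v | MemLp (fun x => (Complex.I * l x) • W v x) 2 ν}
  zero_mem' := by
    refine MemLp.ae_eq ?_ (MemLp.zero' (p := 2) (μ := ν) (ε := K))
    filter_upwards [map_zero_ae W] with x hx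
    rw [hx, smul_zero]
  add_mem' := fun {v w} hv hw => by
    refine MemLp.ae_eq ?_ (MemLp.add hv hw)
    filter_upwards [map_add_ae W v w] with x hx
    rw [hx, Pi.add_apply, smul_add]
  smul_mem' := fun c v hv => by
    refine MemLp.ae_eq ?_ (MemLp.const_smul hv c)
    filter_upwards [map_smul_ae W c v] with x hx
    rw [hx, Pi.smul_apply, smul_comm]

theorem memLp_of_mem_mulSkewDomain (v : mulSkewDomain W l) :
    MemLp (fun x => (Complex.I * l x) • W (v : H) x) 2 ν := v.2

/-- The product of `i l` and an element of the maximal domain. -/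
def mulSkewFun (v : mulSkewDomain W l) : H :=
  W.symm (memLp_of_mem_mulSkewDomain W l v).toLp

theorem map_mulSkewFun (v : mulSkewDomain W l) :
    W (mulSkewFun W l v) =ᵐ[ν] fun x => (Complex.I * l x) • W (v : H) x := by
  rw [mulSkewFun, W.apply_symm_apply]
  exact MemLp.coeFn_toLp _

/-- Multiplication by `i l` on its maximal domain, transported by `W`. -/
def mulSkew : H →ₗ.[ℂ] H where
  domain := mulSkewDomain W l
  toFun :=
    { toFun := mulSkewFun W l
      map_add' := fun v w => by
        refine ext_of_ae W ?_
        filter_upwards [map_mulSkewFun W l (v + w), map_mulSkewFun W l v, map_mulSkewFun W l w,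
          map_add_ae W (mulSkewFun W l v) (mulSkewFun W l w), map_add_ae W (v : H) w]
          with x h1 h2 h3 h4 h5
        rw [h1, h4, h2, h3, Submodule.coe_add, h5, smul_add]
      map_smul' := fun c v => by
        refine ext_of_ae W ?_
        rw [RingHom.id_apply]
        filter_upwards [map_mulSkewFun W l (c • v), map_mulSkewFun W l v,
          map_smul_ae W c (mulSkewFun W l v), map_smul_ae W c (v : H)] with x h1 h2 h3 h4
        rw [h1, h3, h2, Submodule.coe_smul, h4, smul_comm] }

theorem mem_mulSkew_domain {v : H} :
    v ∈ (mulSkew W l).domain ↔ MemLp (fun x => (Complex.I * l x) • W v x) 2 ν := Iff.rfl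

theorem map_mulSkew (v : (mulSkew W l).domain) :
    W (mulSkew W l v) =ᵐ[ν] fun x => (Complex.I * l x) • W (v : H) x :=
  map_mulSkewFun W l v

variable {l}

theorem mem_mulSkew_domain_of_ae {v w : H}
    (h : W w =ᵐ[ν] fun x => (Complex.I * l x) • W v x) : v ∈ (mulSkew W l).domain :=
  (memLp_map W w).ae_eq h

theorem mulSkew_eq_of_ae {v : (mulSkew W l).domain} {w : H}
    (h : W w =ᵐ[ν] fun x => (Complex.I * l x) • W (v : H) x) : mulSkew W l v = w :=
  ext_of_ae W ((map_mulSkew W l v).trans h.symm)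

theorem mulSkew_inner (v w : (mulSkew W l).domain) :
    ⟪mulSkew W l v, (w : H)⟫_ℂ = -⟪(v : H), mulSkew W l w⟫_ℂ := by
  rw [inner_eq_integral W, inner_eq_integral W, ← integral_neg]
  refine integral_congr_ae ?_
  filter_upwards [map_mulSkew W l v, map_mulSkew W l w] with x h1 h2
  rw [h1, h2, inner_smul_left, inner_smul_right]
  simp

/-- The cross term vanishes because `⟪Tv, v⟫` is purely imaginary. With `s = -1` the norm of `(T -
1)v` is the graph norm of `v`. -/
theorem norm_mulSkew_add_sq {s : ℝ} (v : (mulSkew W l).domain) :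
    ‖mulSkew W l v + (s : ℂ) • (v : H)‖ ^ 2 = ‖mulSkew W l v‖ ^ 2 + s ^ 2 * ‖(v : H)‖ ^ 2 := by
  have h1 := mulSkew_inner W v v
  have h2 : (⟪mulSkew W l v, (v : H)⟫_ℂ).re = 0 := by
    have h3 := congrArg Complex.re h1
    rw [← inner_conj_symm (v : H), Complex.neg_re, Complex.conj_re] at h3
    linarith
  have h4 : (RCLike.re ⟪mulSkew W l v, (s : ℂ) • (v : H)⟫_ℂ : ℝ) = 0 := by
    rw [inner_smul_right]
    change ((s : ℂ) * _).re = 0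
    rw [Complex.re_ofReal_mul, h2, mul_zero]
  rw [norm_add_sq (𝕜 := ℂ), h4, norm_smul, Complex.norm_real, mul_pow, Real.norm_eq_abs, sq_abs]
  ring

variable (hl : Measurable l)

include hl in
-- Since `|il + s| ≥ |s| = 1`, multiplication by `(il + s)⁻¹` is bounded and gives the solution.
theorem exists_mulSkew_add_eq {s : ℝ} (hs : |s| = 1) (u : H) :
    ∃ v : (mulSkew W l).domain, mulSkew W l v + (s : ℂ) • (v : H) = u := by
  have hn : ∀ x, 1 ≤ ‖Complex.I * l x + s‖ := fun x => by
    have h := Complex.abs_re_le_norm (Complex.I * l x + s)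
    simpa [hs] using h
  have h0 : ∀ x, Complex.I * l x + s ≠ 0 := fun x hx => by
    have := hn x
    rw [hx, norm_zero] at this
    linarith
  have hm : Measurable fun x => (Complex.I * l x + s)⁻¹ := by fun_prop
  have hb : ∀ x, ‖(Complex.I * l x + s)⁻¹‖ ≤ 1 := fun x => by
    rw [norm_inv]
    exact inv_le_one_of_one_le₀ (hn x)
  have h1 : W (u - (s : ℂ) • mulOp W hm hb u) =ᵐ[ν]
      fun x => (Complex.I * l x) • W (mulOp W hm hb u) x := by
    filter_upwards [map_sub_ae W u ((s : ℂ) • mulOp W hm hb u),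
      map_smul_ae W (s : ℂ) (mulOp W hm hb u), map_mulOp W hm hb u] with x k1 k2 k3
    rw [k1, k2, k3, smul_smul, smul_smul]
    nth_rw 1 [← one_smul ℂ (W u x)]
    rw [← sub_smul]
    congr 1
    field_simp [h0 x]
    ring
  refine ⟨⟨mulOp W hm hb u, mem_mulSkew_domain_of_ae W h1⟩, ?_⟩
  rw [mulSkew_eq_of_ae W (v := ⟨mulOp W hm hb u, mem_mulSkew_domain_of_ae W h1⟩) h1]
  simp

/-- The unitary group generated by multiplication by `i l`. -/
def expOp (t : ℝ) : H →L[ℂ] H :=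
  mulOp W (φ := fun x => Complex.exp (Complex.I * t * l x)) (by fun_prop) fun x => by
    rw [mul_assoc, ← Complex.ofReal_mul, mul_comm, Complex.norm_exp_ofReal_mul_I]

theorem map_expOp (t : ℝ) (v : H) :
    W (expOp W hl t v) =ᵐ[ν] fun x => Complex.exp (Complex.I * t * l x) • W v x :=
  map_mulOp _ _ _ _

theorem inv_I_smul_mulSkew_symm (v w : (Complex.I⁻¹ • mulSkew W l).domain) :
    ⟪(Complex.I⁻¹ • mulSkew W l) v, (w : H)⟫_ℂ = ⟪(v : H), (Complex.I⁻¹ • mulSkew W l) w⟫_ℂ := by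
  have h := mulSkew_inner W (l := l) v w
  rw [LinearPMap.smul_apply, LinearPMap.smul_apply, inner_smul_left, inner_smul_right, h]
  simp

theorem map_inv_I_smul_mulSkew (v : (Complex.I⁻¹ • mulSkew W l).domain) :
    W ((Complex.I⁻¹ • mulSkew W l) v) =ᵐ[ν] fun x => (l x : ℂ) • W (v : H) x := by
  rw [LinearPMap.smul_apply]
  filter_upwards [map_smul_ae W Complex.I⁻¹ (mulSkew W l v), map_mulSkew W l v] with x h1 h2
  rw [h1, h2, smul_smul]
  simp [← mul_assoc]

theorem expOp_expOp_neg (t : ℝ) (v : H) : expOp W hl t (expOp W hl (-t) v) = v := by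
  refine ext_of_ae W ?_
  filter_upwards [map_expOp W hl t (expOp W hl (-t) v), map_expOp W hl (-t) v] with x h1 h2
  rw [h1, h2, smul_smul, ← Complex.exp_add]
  simp

/-- Differentiation under the integral. The dominating function `|il ⟪w, f⟫|` is integrable because
`f` is in the domain; the weak derivative is all that Nelson's criterion needs. -/
theorem hasDerivAt_inner_expOp (w : H) (f : (mulSkew W l).domain) (t : ℝ)
    (h : expOp W hl t (f : H) ∈ (mulSkew W l).domain) :
    HasDerivAt (fun s => ⟪w, expOp W hl s (f : H)⟫_ℂ) ⟪w, mulSkew W l ⟨expOp W hl t f, h⟩⟫_ℂ t := by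
  let F : ℝ → X → ℂ := fun s x => Complex.exp (Complex.I * s * l x) * ⟪W w x, W (f : H) x⟫_ℂ
  let F' : ℝ → X → ℂ := fun s x =>
    Complex.exp (Complex.I * s * l x) * ((Complex.I * l x) * ⟪W w x, W (f : H) x⟫_ℂ)
  have hF : ∀ s, ∫ x, F s x ∂ν = ⟪w, expOp W hl s (f : H)⟫_ℂ := fun s => by
    rw [inner_eq_integral W]
    refine integral_congr_ae ?_
    filter_upwards [map_expOp W hl s (f : H)] with x hx
    rw [hx, inner_smul_right]
  have hF' : ∫ x, F' t x ∂ν = ⟪w, mulSkew W l ⟨expOp W hl t f, h⟩⟫_ℂ := by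
    rw [inner_eq_integral W]
    refine integral_congr_ae ?_
    filter_upwards [map_expOp W hl t (f : H), map_mulSkew W l ⟨expOp W hl t f, h⟩] with x h1 h2
    rw [h2, h1, inner_smul_right, inner_smul_right]
    simp only [F']
    ring
  have hi : Integrable (fun x => ⟪W w x, W (f : H) x⟫_ℂ) ν := L2.integrable_inner _ _
  have hi' : Integrable (fun x => (Complex.I * l x) * ⟪W w x, W (f : H) x⟫_ℂ) ν := by
    refine (L2.integrable_inner (𝕜 := ℂ) (W w) (W (mulSkew W l f))).congr ?_
    filter_upwards [map_mulSkew W l f] with x hx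
    rw [hx, inner_smul_right]
  have hexp : ∀ s : ℝ, Measurable fun x => Complex.exp (Complex.I * s * l x) := fun s => by
    fun_prop
  have hn : ∀ (s : ℝ) (x : X), ‖Complex.exp (Complex.I * s * l x)‖ = 1 := fun s x => by
    rw [mul_assoc, ← Complex.ofReal_mul, mul_comm Complex.I, Complex.norm_exp_ofReal_mul_I]
  have key := hasDerivAt_integral_of_dominated_loc_of_deriv_le (μ := ν) (F := F) (F' := F')
    (x₀ := t) (bound := fun x => ‖(Complex.I * l x) * ⟪W w x, W (f : H) x⟫_ℂ‖) (s := Set.univ)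
    univ_mem
    (Eventually.of_forall fun s => (hexp s).aestronglyMeasurable.mul hi.1)
    (hi.bdd_mul (hexp t).aestronglyMeasurable (ae_of_all _ fun x => (hn t x).le))
    ((hexp t).aestronglyMeasurable.mul hi'.1)
    (ae_of_all _ fun x s _ => by
      change ‖_ * _‖ ≤ _
      rw [norm_mul, hn, one_mul])
    hi'.norm
    (ae_of_all _ fun x s _ => by
      have h1 : HasDerivAt (fun s : ℝ => Complex.I * (s : ℂ) * l x) (Complex.I * 1 * l x) s :=
        ((Complex.ofRealCLM.hasDerivAt (x := s)).const_mul Complex.I).mul_const _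
      have h2 := h1.cexp.mul_const ⟪W w x, W (f : H) x⟫_ℂ
      convert! h2 using 1
      simp only [F']
      ring)
  have h3 := key.2
  simp only [hF, hF'] at h3
  exact h3

variable [CompleteSpace H]

include hl in
-- A skew-symmetric `T` for which `T + 1` and `T - 1` are both onto has no proper extension by its
-- adjoint.
theorem mulSkew_adjoint (hd : Dense ((mulSkew W l).domain : Set H)) :
    (mulSkew W l).adjoint = -mulSkew W l := by
  refine le_antisymm ?_ ?_
  · have key : ∀ y : (mulSkew W l).adjoint.domain, ∃ v : (mulSkew W l).domain,
        (v : H) = y ∧ -mulSkew W l v = (mulSkew W l).adjoint y := by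
      intro y
      -- Solve `(1 - T)v = (T* + 1)y`. Then `v - y` is orthogonal to the range of `T + 1`, which is
      -- everything, so `v = y`.
      obtain ⟨v, hv⟩ := exists_mulSkew_add_eq W hl (s := -1) (by simp)
        (-((mulSkew W l).adjoint y + (y : H)))
      have hv' : -mulSkew W l v + (v : H) = (mulSkew W l).adjoint y + (y : H) := by
        rw [← neg_inj, ← hv]
        push_cast
        module
      have h1 : (v : H) - y = 0 := by
        obtain ⟨w, hw⟩ := exists_mulSkew_add_eq W hl (s := 1) (by simp) ((v : H) - y)
        have h2 : ⟪(v : H) - y, (v : H) - y⟫_ℂ = 0 := by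
          nth_rw 2 [← hw]
          have h3 := (mulSkew W l).adjoint_isFormalAdjoint hd y w
          have h4 := congrArg (fun z => ⟪z, (w : H)⟫_ℂ) hv'
          simp only [inner_add_left, inner_neg_left, mulSkew_inner, h3] at h4
          rw [Complex.ofReal_one, one_smul, inner_sub_left, inner_add_right, inner_add_right]
          linear_combination h4
        exact inner_self_eq_zero.mp h2
      have h2 := sub_eq_zero.mp h1
      refine ⟨v, h2, ?_⟩
      rw [h2] at hv'
      exact add_right_cancel hv'
    refine ⟨fun y hy => ?_, ?_⟩
    · obtain ⟨v, hv, -⟩ := key ⟨y, hy⟩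
      have hv' : (v : H) = y := hv
      rw [← hv']
      exact v.2
    · intro y w hyw
      obtain ⟨v, hv, hv2⟩ := key y
      have : w = v := Subtype.ext (hyw.symm.trans hv.symm)
      rw [← hv2, this]
      rfl
  · refine LinearPMap.IsFormalAdjoint.le_adjoint hd ?_
    intro v w
    rw [LinearPMap.neg_apply, inner_neg_right]
    exact mulSkew_inner W v w

include hl in
-- An adjoint is closed, and the graphs of `T` and `T* = -T` differ by a sign flip.
theorem mulSkew_isClosed (hd : Dense ((mulSkew W l).domain : Set H)) : (mulSkew W l).IsClosed := by
  have h1 := LinearPMap.adjoint_isClosed hd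
  rw [mulSkew_adjoint W hl hd, LinearPMap.IsClosed] at h1
  have h2 : ((mulSkew W l).graph : Set (H × H)) =
      (fun p : H × H => (p.1, -p.2)) ⁻¹' (-mulSkew W l).graph := by
    ext ⟨x, y⟩
    simp only [SetLike.mem_coe, Set.mem_preimage, LinearPMap.mem_graph_iff]
    constructor
    · rintro ⟨v, h1, h2⟩
      exact ⟨v, h1, by rw [LinearPMap.neg_apply, h2]⟩
    · rintro ⟨v, h1, h2⟩
      exact ⟨v, h1, neg_injective (by rw [← h2, LinearPMap.neg_apply])⟩
  rw [LinearPMap.IsClosed, h2]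
  exact h1.preimage (by fun_prop)

theorem mulPVM_isSpectralMeasureOf :
    (mulPVM W hl).IsSpectralMeasureOf (Complex.I⁻¹ • mulSkew W l) := by
  refine ⟨fun v => ?_, fun v => ?_⟩
  · rw [scalarMeasure_mulPVM, integrable_distMeasure_iff W hl (by fun_prop), LinearPMap.smul_domain,
      mem_mulSkew_domain, memLp_two_iff_integrable_sq_norm]
    · refine integrable_congr (ae_of_all _ fun x => ?_)
      simp [norm_smul, mul_pow, mul_comm]
    · exact (by fun_prop : Measurable fun x => Complex.I * (l x : ℂ)).aestronglyMeasurable.smul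
        (memLp_map W v).1
  · rw [scalarMeasure_mulPVM, integral_distMeasure W hl (by fun_prop), inner_eq_integral W,
      ← integral_complex_ofReal]
    refine integral_congr_ae ?_
    filter_upwards [map_inv_I_smul_mulSkew W v] with x hx
    rw [hx, inner_smul_right, inner_self_eq_norm_sq_to_K]
    push_cast [smul_eq_mul]
    exact mul_comm _ _

/-- The lower bound required of `mulPVM` is pointwise: `|l - c| ≥ δ` wherever `l` is outside `(c-δ,
c+δ)`. -/
theorem eq_mulPVM_of_isSpectralMeasureOf (hd : Dense ((mulSkew W l).domain : Set H))
    {E : ProjectionValuedMeasure H} (hE : E.IsSpectralMeasureOf (Complex.I⁻¹ • mulSkew W l)) :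
    E = mulPVM W hl := by
  refine hE.eq_of_lower_bound hd (inv_I_smul_mulSkew_symm W) _ fun c δ hδ w => ?_
  have hS : MeasurableSet (Set.Ioo (c - δ) (c + δ))ᶜ := measurableSet_Ioo.compl
  rw [mulPVM_proj W hl hS]
  have h1 : δ * ‖indOp W (hl hS) (w : H)‖ = ‖(δ : ℂ) • indOp W (hl hS) (w : H)‖ := by
    rw [norm_smul, Complex.norm_real, Real.norm_eq_abs, abs_of_pos hδ]
  rw [h1]
  refine norm_le_of_map_le W ?_
  set Tw := (Complex.I⁻¹ • mulSkew W l) w with hTw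
  filter_upwards [map_smul_ae W (δ : ℂ) (indOp W (hl hS) (w : H)), map_indOp W (hl hS) (w : H),
    map_indOp W (hl hS) (Tw - (c : ℂ) • (w : H)), map_sub_ae W Tw ((c : ℂ) • (w : H)),
    map_smul_ae W (c : ℂ) (w : H), map_inv_I_smul_mulSkew W w] with x k1 k2 k3 k4 k5 k6
  rw [k1, k2, k3]
  by_cases hx : x ∈ l ⁻¹' (Set.Ioo (c - δ) (c + δ))ᶜ
  · rw [Set.indicator_of_mem hx, Set.indicator_of_mem hx, k4, k5, hTw, k6, ← sub_smul, norm_smul,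
      norm_smul, ← Complex.ofReal_sub, Complex.norm_real, Complex.norm_real, Real.norm_eq_abs,
      abs_of_pos hδ, Real.norm_eq_abs]
    refine mul_le_mul_of_nonneg_right ?_ (norm_nonneg _)
    by_contra h
    rw [not_le, abs_lt] at h
    exact hx ⟨by linarith, by linarith⟩
  · rw [Set.indicator_of_notMem hx, Set.indicator_of_notMem hx, smul_zero]

theorem expOp_isIntegral (t : ℝ) :
    (mulPVM W hl).IsIntegral (fun y => Complex.exp (Complex.I * t * y)) (expOp W hl t) := by
  intro v
  rw [scalarMeasure_mulPVM, integral_distMeasure W hl (by fun_prop), inner_eq_integral W]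
  refine integral_congr_ae ?_
  filter_upwards [map_expOp W hl t v] with x hx
  rw [hx, inner_smul_right, inner_self_eq_norm_sq_to_K, Complex.real_smul]
  push_cast
  exact mul_comm _ _

theorem expOp_adjoint (t : ℝ) : star (expOp W hl t) = expOp W hl (-t) := by
  rw [ContinuousLinearMap.star_eq_adjoint]
  refine ((ContinuousLinearMap.eq_adjoint_iff _ _).mpr fun v w => ?_).symm
  rw [inner_eq_integral W, inner_eq_integral W]
  refine integral_congr_ae ?_
  filter_upwards [map_expOp W hl t w, map_expOp W hl (-t) v] with x h1 h2
  rw [h1, h2, inner_smul_left, inner_smul_right, ← Complex.exp_conj]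
  simp

theorem expOp_mem_unitary (t : ℝ) : expOp W hl t ∈ unitary (H →L[ℂ] H) := by
  have h : ∀ s, expOp W hl s * expOp W hl (-s) = 1 := fun s =>
    ContinuousLinearMap.ext (expOp_expOp_neg W hl s)
  rw [Unitary.mem_iff, expOp_adjoint]
  refine ⟨?_, h t⟩
  have := h (-t)
  rwa [neg_neg] at this

/-- A densely defined restriction of `mulSkew` whose domain is invariant under the unitary group
has `mulSkew` as its closure. -/
theorem closure_eq_mulSkew {A : H →ₗ.[ℂ] H} (hA : A ≤ mulSkew W l)
    (hd : Dense (A.domain : Set H)) (hinv : ∀ t, ∀ v ∈ A.domain, expOp W hl t v ∈ A.domain) :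
    A.IsClosable ∧ A.closure = mulSkew W l := by
  have hd' : Dense ((mulSkew W l).domain : Set H) := hd.mono hA.1
  have hcl : (mulSkew W l).IsClosed := mulSkew_isClosed W hl hd'
  have hA1 : A.IsClosable := hcl.isClosable.leIsClosable hA
  refine ⟨hA1, ?_⟩
  let R : Submodule ℂ H := LinearMap.range (A.toFun - A.domain.subtype)
  -- Range of `A - 1`; a vector `w` orthogonal to it satisfies `⟪w, Af⟫ = ⟪w, f⟫` on the domain.
  have hR : R.topologicalClosure = ⊤ := by
    rw [Submodule.topologicalClosure_eq_top_iff, Submodule.eq_bot_iff]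
    intro w hw
    have hw1 : ∀ f : A.domain, ⟪w, A f⟫_ℂ = ⟪w, (f : H)⟫_ℂ := fun f => by
      have := (Submodule.mem_orthogonal' _ _).mp hw (A f - f) ⟨f, rfl⟩
      rwa [inner_sub_right, sub_eq_zero] at this
    refine hd.eq_zero_of_inner_left ℂ fun f hf => ?_
    let g : ℝ → ℂ := fun t => ⟪w, expOp W hl t f⟫_ℂ
    -- Invariance of the domain enters here: the identity for `w` is applied to `U_t f`.
    have hg : ∀ t, HasDerivAt g (g t) t := by
      intro t
      have h1 : g t = ⟪w, mulSkew W l ⟨expOp W hl t f, hA.1 (hinv t f hf)⟩⟫_ℂ := by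
        refine (hw1 ⟨expOp W hl t f, hinv t f hf⟩).symm.trans ?_
        congr 1
        exact hA.2 rfl
      rw [h1]
      exact hasDerivAt_inner_expOp W hl w ⟨f, hA.1 hf⟩ t _
    have hconst : ∀ t : ℝ, Complex.exp (-t) * g t = g 0 := by
      intro t
      have h1 : ∀ s : ℝ, HasDerivAt (fun s : ℝ => Complex.exp (-s) * g s) 0 s := fun s => by
        have h2 : HasDerivAt (fun s : ℝ => Complex.exp (-s)) (Complex.exp (-s) * (-1)) s :=
          ((Complex.ofRealCLM.hasDerivAt (x := s)).neg).cexp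
        convert! h2.mul (hg s) using 1
        ring
      have h3 := is_const_of_deriv_eq_zero (fun s => (h1 s).differentiableAt)
        (fun s => (h1 s).deriv) t 0
      simpa using h3
    have hbound : ∀ t, ‖g t‖ ≤ ‖w‖ * ‖f‖ := fun t => by
      refine (norm_inner_le_norm _ _).trans (mul_le_mul_of_nonneg_left ?_ (norm_nonneg _))
      refine norm_le_of_map_le W ?_
      filter_upwards [map_expOp W hl t f] with x hx
      rw [hx, norm_smul, mul_assoc, ← Complex.ofReal_mul, mul_comm Complex.I,
        Complex.norm_exp_ofReal_mul_I, one_mul]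
    have hg0 : g 0 = ⟪w, f⟫_ℂ := by
      have : expOp W hl 0 f = f := by
        refine ext_of_ae W ?_
        filter_upwards [map_expOp W hl 0 f] with x hx
        rw [hx]; simp
      change ⟪w, expOp W hl 0 f⟫_ℂ = _
      rw [this]
    -- `g(t) = e^t g(0)` is bounded, so letting `t → ∞` gives `g(0) = 0`.
    have hle : ∀ t : ℝ, ‖g 0‖ ≤ Real.exp (-t) * (‖w‖ * ‖f‖) := fun t => by
      rw [← hconst t, norm_mul, ← Complex.ofReal_neg, Complex.norm_exp_ofReal]
      exact mul_le_mul_of_nonneg_left (hbound t) (Real.exp_nonneg _)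
    rw [← hg0, ← norm_le_zero_iff]
    have hlim : Tendsto (fun t : ℝ => Real.exp (-t) * (‖w‖ * ‖f‖)) atTop (𝓝 0) := by
      simpa using Real.tendsto_exp_neg_atTop_nhds_zero.mul_const (‖w‖ * ‖f‖)
    exact ge_of_tendsto' hlim hle
  refine LinearPMap.eq_of_eq_graph ?_
  rw [← hA1.graph_closure_eq_closure_graph]
  refine le_antisymm (Submodule.topologicalClosure_minimal _ (LinearPMap.le_graph_of_le hA) hcl) ?_
  rintro ⟨v, u⟩ hvu
  obtain ⟨v', rfl, rfl⟩ := (LinearPMap.mem_graph_iff _).mp hvu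
  rw [← SetLike.mem_coe, Submodule.topologicalClosure_coe, Metric.mem_closure_iff]
  intro ε hε
  have h1 : mulSkew W l v' - (v' : H) ∈ R.topologicalClosure := hR ▸ Submodule.mem_top
  rw [← SetLike.mem_coe, Submodule.topologicalClosure_coe, Metric.mem_closure_iff] at h1
  obtain ⟨_, ⟨f, rfl⟩, hf⟩ := h1 ε hε
  have hfd := hA.1 f.2
  have hAf : A f = mulSkew W l ⟨f, hfd⟩ := hA.2 rfl
  refine ⟨(f, A f), LinearPMap.mem_graph _ _, ?_⟩
  -- Approximation of `(T - 1)v'` by `(T - 1)f` is approximation of `v'` by `f` in the graph norm.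
  have h2 := norm_mulSkew_add_sq W (s := -1) (v' - ⟨f, hfd⟩)
  have h3 : mulSkew W l (v' - ⟨f, hfd⟩) + ((-1 : ℝ) : ℂ) • ((v' - ⟨f, hfd⟩ : _) : H) =
      mulSkew W l v' - (v' : H) - (A f - (f : H)) := by
    rw [LinearPMap.map_sub, ← hAf, Submodule.coe_sub]
    push_cast
    module
  rw [h3] at h2
  rw [dist_eq_norm] at hf
  change ‖mulSkew W l v' - (v' : H) - (A f - (f : H))‖ < ε at hf
  rw [Prod.dist_eq, max_lt_iff, dist_eq_norm, dist_eq_norm, hAf]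
  change ‖((v' - ⟨f, hfd⟩ : (mulSkew W l).domain) : H)‖ < ε ∧
    ‖mulSkew W l v' - mulSkew W l ⟨f, hfd⟩‖ < ε
  rw [← LinearPMap.map_sub]
  constructor <;> refine lt_of_le_of_lt ?_ hf <;>
    refine (sq_le_sq₀ (norm_nonneg _) (norm_nonneg _)).mp ?_ <;> rw [h2]
  · nlinarith [sq_nonneg ‖mulSkew W l (v' - ⟨f, hfd⟩)‖]
  · nlinarith [sq_nonneg ‖((v' - ⟨f, hfd⟩ : (mulSkew W l).domain) : H)‖]

end SkewMultiplication

/-! ### Integration in logarithmic polar coordinates -/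

section Polar

variable {N : ℕ}

theorem measurable_invSqDensity :
    Measurable (fun x : EuclideanSpace ℝ (Fin N) => ENNReal.ofReal ((‖x‖ ^ 2)⁻¹)) := by
  fun_prop

theorem lintegral_volumeIoiPow (n : ℕ) {h : ℝ → ENNReal} (hh : Measurable h) :
    ∫⁻ r : Set.Ioi (0 : ℝ), h r ∂(Measure.volumeIoiPow n) =
      ∫⁻ s : ℝ, ENNReal.ofReal (2 * Real.exp (2 * s)) *
        (ENNReal.ofReal (Real.exp (2 * s) ^ n) * h (Real.exp (2 * s))) := by
  have h1 : Measurable fun r : Set.Ioi (0 : ℝ) => ENNReal.ofReal (r.1 ^ n) := by fun_prop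
  rw [Measure.volumeIoiPow, lintegral_withDensity_eq_lintegral_mul _ h1 (by fun_prop)]
  simp only [Pi.mul_apply]
  rw [lintegral_subtype_comap (μ := volume) measurableSet_Ioi
    (fun r : ℝ => ENNReal.ofReal (r ^ n) * h r)]
  have h2 : (fun s : ℝ => Real.exp (2 * s)) '' Set.univ = Set.Ioi 0 := by
    rw [Set.image_univ]
    ext r
    simp only [Set.mem_range, Set.mem_Ioi]
    constructor
    · rintro ⟨s, rfl⟩
      exact Real.exp_pos _
    · intro hr
      exact ⟨Real.log r / 2, by rw [mul_div_cancel₀ _ two_ne_zero, Real.exp_log hr]⟩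
  rw [← h2, lintegral_image_eq_lintegral_abs_deriv_mul (f' := fun s => 2 * Real.exp (2 * s))
    MeasurableSet.univ]
  · rw [setLIntegral_univ]
    refine lintegral_congr fun s => ?_
    rw [abs_of_pos (by positivity)]
  · intro s _
    have := ((hasDerivAt_id s).const_mul 2).exp
    simp only [id, mul_one] at this
    rw [mul_comm 2 (Real.exp _)]
    exact this.hasDerivWithinAt
  · intro s _ t _ hst
    have := Real.exp_injective hst
    linarith

/-- Polar coordinates with `r = e^{2s}`: the factors `r^{N-1}`, `r⁻²` and `dr = 2e^{2s} ds`
contribute the exponents `2(N-1)s`, `-4s` and `2s`. -/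
theorem lintegral_invSqMeasure (hN : 1 ≤ N) {g : EuclideanSpace ℝ (Fin N) → ENNReal}
    (hg : Measurable g) :
    ∫⁻ x, g x ∂(invSqMeasure N) = ∫⁻ s : ℝ,
      ENNReal.ofReal (2 * Real.exp (2 * ((N : ℝ) - 2) * s)) *
        ∫⁻ w : Metric.sphere (0 : EuclideanSpace ℝ (Fin N)) 1,
          g (Real.exp (2 * s) • (w : EuclideanSpace ℝ (Fin N)))
          ∂(volume : Measure (EuclideanSpace ℝ (Fin N))).toSphere := by
  have : Nonempty (Fin N) := ⟨⟨0, hN⟩⟩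
  set σ := (volume : Measure (EuclideanSpace ℝ (Fin N))).toSphere
  set G : EuclideanSpace ℝ (Fin N) → ENNReal := fun x => ENNReal.ofReal ((‖x‖ ^ 2)⁻¹) * g x
  have hG : Measurable G := measurable_invSqDensity.mul hg
  have hGr : Measurable fun p : Metric.sphere (0 : EuclideanSpace ℝ (Fin N)) 1 × ℝ =>
      G (p.2 • (p.1 : EuclideanSpace ℝ (Fin N))) := by
    refine hG.comp ?_
    fun_prop
  have hGr' : Measurable fun z : Metric.sphere (0 : EuclideanSpace ℝ (Fin N)) 1 × Set.Ioi (0 : ℝ) =>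
      G ((z.2 : ℝ) • (z.1 : EuclideanSpace ℝ (Fin N))) := by
    refine hG.comp ?_
    fun_prop
  have h1 : ∫⁻ x, g x ∂(invSqMeasure N) = ∫⁻ x, G x := by
    rw [invSqMeasure, lintegral_withDensity_eq_lintegral_mul _ measurable_invSqDensity hg]
    rfl
  have h2 : ∫⁻ x, G x = ∫⁻ x : ({0}ᶜ : Set (EuclideanSpace ℝ (Fin N))), G x
      ∂(volume.comap Subtype.val) := by
    rw [lintegral_subtype_comap (μ := volume) (measurableSet_singleton _).compl G,
      restrict_compl_singleton]
  have hmp := (volume : Measure (EuclideanSpace ℝ (Fin N))).measurePreserving_homeomorphUnitSphereProd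
  have h3 : ∫⁻ x : ({0}ᶜ : Set (EuclideanSpace ℝ (Fin N))), G x ∂(volume.comap Subtype.val) =
      ∫⁻ z : Metric.sphere (0 : EuclideanSpace ℝ (Fin N)) 1 × Set.Ioi (0 : ℝ),
        G ((z.2 : ℝ) • (z.1 : EuclideanSpace ℝ (Fin N)))
        ∂(σ.prod (Measure.volumeIoiPow (N - 1))) := by
    rw [finrank_euclideanSpace_fin] at hmp
    rw [← hmp.lintegral_comp hGr']
    refine lintegral_congr fun x => ?_
    congr 1
    have h4 := (homeomorphUnitSphereProd (EuclideanSpace ℝ (Fin N))).symm_apply_apply x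
    have h5 := homeomorphUnitSphereProd_symm_apply_coe (EuclideanSpace ℝ (Fin N))
      (homeomorphUnitSphereProd (EuclideanSpace ℝ (Fin N)) x)
    rw [h4] at h5
    exact h5
  rw [h1, h2, h3, lintegral_prod_symm _ hGr'.aemeasurable]
  rw [lintegral_volumeIoiPow (N - 1)
    (h := fun r => ∫⁻ w : Metric.sphere (0 : EuclideanSpace ℝ (Fin N)) 1,
      G (r • (w : EuclideanSpace ℝ (Fin N))) ∂σ) hGr.lintegral_prod_left']
  refine lintegral_congr fun s => ?_
  have h6 : ∀ w : Metric.sphere (0 : EuclideanSpace ℝ (Fin N)) 1,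
      G (Real.exp (2 * s) • (w : EuclideanSpace ℝ (Fin N))) =
        ENNReal.ofReal ((Real.exp (2 * s) ^ 2)⁻¹) *
          g (Real.exp (2 * s) • (w : EuclideanSpace ℝ (Fin N))) := fun w => by
    simp only [G]
    rw [norm_smul, norm_eq_of_mem_sphere, mul_one, Real.norm_eq_abs, Real.abs_exp]
  simp only [h6]
  rw [lintegral_const_mul _ (by fun_prop), ← mul_assoc, ← mul_assoc, ← ENNReal.ofReal_mul
    (by positivity), ← ENNReal.ofReal_mul (by positivity)]
  congr 2
  rw [mul_assoc, mul_assoc]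
  congr 1
  rw [← Real.exp_nat_mul, ← Real.exp_nat_mul, ← Real.exp_neg, ← Real.exp_add, ← Real.exp_add,
    Nat.cast_sub hN]
  congr 1
  push_cast
  ring

end Polar

/-! ### Density of the domain -/

section Density

open MvPolynomial

variable {N : ℕ}

/-- Every continuous function on a compact set is a uniform limit of polynomials. -/
theorem exists_poly_approx {C : Set (EuclideanSpace ℝ (Fin N))} (hC : IsCompact C)
    {G : EuclideanSpace ℝ (Fin N) → ℂ} (hG : Continuous G) {ε : ℝ} (hε : 0 < ε) :
    ∃ Q : MvPolynomial (Fin N) ℂ, ∀ x ∈ C, ‖eval (fun j => ((x j : ℝ) : ℂ)) Q - G x‖ < ε := by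
  have : CompactSpace C := isCompact_iff_compactSpace.mp hC
  let X : Fin N → C(C, ℂ) := fun j =>
    ⟨fun x => (((x : EuclideanSpace ℝ (Fin N)) j : ℝ) : ℂ), by fun_prop⟩
  -- The coordinates are real, so the star subalgebra that they generate consists of polynomials in
  -- them alone.
  have hX : star (Set.range X) = Set.range X := by
    have h1 : ∀ j, star (X j) = X j := fun j => by
      ext x
      exact Complex.conj_ofReal _
    ext f
    constructor
    · rintro ⟨j, hj⟩
      exact ⟨j, by rw [← star_star f, ← hj, h1]⟩
    · rintro ⟨j, rfl⟩
      exact ⟨j, (h1 j).symm⟩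
  let A : StarSubalgebra ℂ C(C, ℂ) := StarAlgebra.adjoin ℂ (Set.range X)
  have hA : A.topologicalClosure = ⊤ := by
    refine ContinuousMap.starSubalgebra_topologicalClosure_eq_top_of_separatesPoints A ?_
    intro x y hxy
    have h2 : ∃ j, (x : EuclideanSpace ℝ (Fin N)) j ≠ (y : EuclideanSpace ℝ (Fin N)) j := by
      by_contra h
      push Not at h
      exact hxy (Subtype.ext (PiLp.ext h))
    obtain ⟨j, hj⟩ := h2
    refine ⟨X j, ⟨X j, StarAlgebra.subset_adjoin ℂ _ ⟨j, rfl⟩, rfl⟩, fun h => hj ?_⟩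
    exact Complex.ofReal_injective h
  let G' : C(C, ℂ) := ⟨fun x => G x, by fun_prop⟩
  have h1 : G' ∈ A.topologicalClosure := hA ▸ StarSubalgebra.mem_top
  rw [← SetLike.mem_coe, StarSubalgebra.topologicalClosure_coe, Metric.mem_closure_iff] at h1
  obtain ⟨f, hf, hfG⟩ := h1 ε hε
  have hf' : f ∈ (aeval X : MvPolynomial (Fin N) ℂ →ₐ[ℂ] C(C, ℂ)).range := by
    rw [← Algebra.adjoin_range_eq_range_aeval]
    have h2 : f ∈ A.toSubalgebra := hf
    rwa [StarAlgebra.adjoin_toSubalgebra, hX, Set.union_self] at h2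
  obtain ⟨Q, rfl⟩ := hf'
  refine ⟨Q, fun x hx => ?_⟩
  have h3 : ∀ y : C, (aeval X Q : C(C, ℂ)) y =
      eval (fun j => (((y : EuclideanSpace ℝ (Fin N)) j : ℝ) : ℂ)) Q := fun y => by
    have h4 := MvPolynomial.comp_aeval_apply (φ := ContinuousMap.evalAlgHom ℂ ℂ y) X Q
    rw [← MvPolynomial.coe_aeval_eq_eval]
    exact h4
  have h5 := ContinuousMap.dist_lt_iff hε |>.mp hfG ⟨x, hx⟩
  rw [dist_comm, dist_eq_norm] at h5
  rw [← h3 ⟨x, hx⟩]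
  exact h5

theorem eval_mul_of_isHomogeneous {m : ℕ} {P : MvPolynomial (Fin N) ℂ} (hP : P.IsHomogeneous m)
    (c : ℂ) (g : Fin N → ℂ) : eval (fun j => c * g j) P = c ^ m * eval g P := by
  rw [eval_eq', eval_eq', Finset.mul_sum]
  refine Finset.sum_congr rfl fun d hd => ?_
  have h : ∑ j, d j = m := by
    have := hP (mem_support_iff.mp hd)
    simpa [Finsupp.weight_apply, Finsupp.sum_fintype] using this
  simp only [mul_pow, Finset.prod_mul_distrib, Finset.prod_pow_eq_pow_sum, h]
  ring

theorem IsRadialTest.pow_mul {f : ℝ → ℂ} (hf : IsRadialTest f) (m : ℕ) :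
    IsRadialTest fun r => (r : ℂ) ^ m * f r := by
  obtain ⟨h1, h2, h3⟩ := hf
  exact ⟨(Complex.ofRealCLM.contDiff.pow m).mul h1, h2.mul_left,
    (tsupport_mul_subset_right).trans h3⟩

/-- The product of a polynomial and a radial test function is in the domain. -/
theorem poly_mul_radial_mem (hN : 1 ≤ N) (Q : MvPolynomial (Fin N) ℂ) {f : ℝ → ℂ}
    (hf : IsRadialTest f) :
    (fun x : EuclideanSpace ℝ (Fin N) => eval (fun j => ((x j : ℝ) : ℂ)) Q * f ‖x‖) ∈
      testDomain N := by
  have f0 : f 0 = 0 := image_eq_zero_of_notMem_tsupport fun h => lt_irrefl (0 : ℝ) (hf.2.2 h)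
  -- For homogeneous `P`, `P(rω) f(r) = P(ω) · r^m f(r)`, and `r^m f` is again a radial test
  -- function.
  have key : ∀ (m : ℕ) (P : MvPolynomial (Fin N) ℂ), P.IsHomogeneous m →
      (fun x : EuclideanSpace ℝ (Fin N) => eval (fun j => ((x j : ℝ) : ℂ)) P * f ‖x‖) ∈
        testDomain N := by
    intro m P hP
    refine Submodule.subset_span ⟨restrictSphere N P, restrictSphere_mem hN P,
      fun r => (r : ℂ) ^ m * f r, hf.pow_mul m, ?_⟩
    funext x
    by_cases hx : x = 0
    · subst hx
      simp [sphTensor, f0]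
    · rw [sphTensor, dif_pos hx, ← mul_assoc]
      congr 1
      simp only [restrictSphere, LinearMap.coe_mk, AddHom.coe_mk]
      have h1 : (fun j => ((x j : ℝ) : ℂ)) =
          fun j => (‖x‖ : ℂ) * ((((‖x‖⁻¹ • x : EuclideanSpace ℝ (Fin N)) j : ℝ) : ℂ)) := by
        funext j
        rw [← Complex.ofReal_mul, PiLp.smul_apply, smul_eq_mul, mul_inv_cancel_left₀]
        exact norm_ne_zero_iff.mpr hx
      rw [h1, eval_mul_of_isHomogeneous hP, mul_comm]
  have h1 : (fun x : EuclideanSpace ℝ (Fin N) => eval (fun j => ((x j : ℝ) : ℂ)) Q * f ‖x‖) =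
      ∑ m ∈ Finset.range (Q.totalDegree + 1), fun x : EuclideanSpace ℝ (Fin N) =>
        eval (fun j => ((x j : ℝ) : ℂ)) (homogeneousComponent m Q) * f ‖x‖ := by
    funext x
    rw [Finset.sum_apply, ← Finset.sum_mul, ← map_sum, sum_homogeneousComponent]
  rw [h1]
  exact Submodule.sum_mem _ fun m _ => key m _ (homogeneousComponent_isHomogeneous m Q)

/-- Uniform approximation by elements of the domain with supports in a fixed compact set. -/
theorem exists_testDomain_approx (hN : 1 ≤ N) {G : EuclideanSpace ℝ (Fin N) → ℂ}
    (hG : Continuous G) (hG1 : HasCompactSupport G)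
    (hG2 : (0 : EuclideanSpace ℝ (Fin N)) ∉ tsupport G) :
    ∃ C : Set (EuclideanSpace ℝ (Fin N)), IsCompact C ∧ 0 ∉ C ∧ tsupport G ⊆ C ∧
      ∀ ε : ℝ, 0 < ε → ∃ F ∈ testDomain N, (∀ x, ‖F x - G x‖ ≤ ε) ∧ ∀ x ∉ C, F x = 0 := by
  obtain ⟨a, ha, ha'⟩ : ∃ a : ℝ, 0 < a ∧ ∀ x ∈ tsupport G, a ≤ ‖x‖ := by
    have h1 : (tsupport G)ᶜ ∈ 𝓝 (0 : EuclideanSpace ℝ (Fin N)) :=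
      (isClosed_tsupport G).isOpen_compl.mem_nhds hG2
    obtain ⟨a, ha, h2⟩ := Metric.mem_nhds_iff.mp h1
    refine ⟨a, ha, fun x hx => ?_⟩
    by_contra h
    exact h2 (mem_ball_zero_iff.mpr (not_le.mp h)) hx
  obtain ⟨R, hR⟩ := hG1.isBounded.subset_closedBall 0
  set b := max R (a + 1)
  have hab : a + 1 ≤ b := le_max_right _ _
  have hb : ∀ x ∈ tsupport G, ‖x‖ ≤ b := fun x hx =>
    (mem_closedBall_zero_iff.mp (hR hx)).trans (le_max_left _ _)
  -- `χ` is `1` on `[a, b]`, which contains the norms of all points of the support of `G`, and is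
  -- supported in `[a/2, b + a/2]`, away from `0`.
  let χ : ContDiffBump ((a + b) / 2) := ⟨(b - a) / 2, (b - a) / 2 + a / 2, by linarith, by linarith⟩
  have hχ : IsRadialTest fun r => ((χ r : ℝ) : ℂ) := by
    have h1 : tsupport (fun r => ((χ r : ℝ) : ℂ)) ⊆ tsupport χ :=
      tsupport_comp_subset (g := Complex.ofReal) Complex.ofReal_zero χ
    refine ⟨Complex.ofRealCLM.contDiff.comp χ.contDiff, χ.hasCompactSupport.of_isClosed_subset
      (isClosed_tsupport _) h1, h1.trans ?_⟩
    rw [χ.tsupport_eq, Real.closedBall_eq_Icc]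
    intro r hr
    have := hr.1
    simp only [χ] at this
    simp only [Set.mem_Ioi]
    linarith
  let C : Set (EuclideanSpace ℝ (Fin N)) := (fun x => ‖x‖) ⁻¹' (tsupport χ)
  have hCeq : ∀ x, x ∈ C ↔ a / 2 ≤ ‖x‖ ∧ ‖x‖ ≤ b + a / 2 := fun x => by
    simp only [C, Set.mem_preimage, χ.tsupport_eq, Real.closedBall_eq_Icc, Set.mem_Icc, χ]
    constructor <;> rintro ⟨h1, h2⟩ <;> constructor <;> linarith
  have hCc : IsCompact C := by
    refine (isCompact_closedBall (0 : EuclideanSpace ℝ (Fin N)) (b + a / 2)).of_isClosed_subset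
      ((isClosed_tsupport _).preimage continuous_norm) fun x hx => ?_
    exact mem_closedBall_zero_iff.mpr ((hCeq x).mp hx).2
  refine ⟨C, hCc, fun h => ?_, fun x hx => ?_, fun ε hε => ?_⟩
  · have := ((hCeq 0).mp h).1
    rw [norm_zero] at this
    linarith
  · have := ha' x hx
    have := hb x hx
    exact (hCeq x).mpr ⟨by linarith, by linarith⟩
  -- The approximant is `Q(x) χ(|x|)`; as `G = G χ(|x|)`, the cutoff does not increase the error.
  · obtain ⟨Q, hQ⟩ := exists_poly_approx hCc hG hε
    refine ⟨_, poly_mul_radial_mem hN Q hχ, fun x => ?_, fun x hx => ?_⟩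
    · by_cases hx : x ∈ C
      · have h1 : G x = G x * ((χ ‖x‖ : ℝ) : ℂ) := by
          by_cases hGx : x ∈ tsupport G
          · rw [χ.one_of_mem_closedBall]
            · simp
            · have := ha' x hGx
              have := hb x hGx
              rw [Real.closedBall_eq_Icc]
              simp only [χ]
              constructor <;> linarith
          · rw [image_eq_zero_of_notMem_tsupport hGx, zero_mul]
        rw [h1, ← sub_mul, norm_mul, Complex.norm_real, Real.norm_eq_abs, abs_of_nonneg χ.nonneg]
        exact (mul_le_of_le_one_right (norm_nonneg _) χ.le_one).trans (hQ x hx).le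
      · have h1 : χ ‖x‖ = 0 := image_eq_zero_of_notMem_tsupport hx
        have h2 : G x = 0 := by
          refine image_eq_zero_of_notMem_tsupport fun h => hx ?_
          have := ha' x h
          have := hb x h
          exact (hCeq x).mpr ⟨by linarith, by linarith⟩
        rw [h1, h2]
        simpa using hε.le
    · have h1 : χ ‖x‖ = 0 := image_eq_zero_of_notMem_tsupport hx
      simp only [h1, Complex.ofReal_zero, mul_zero]

theorem invSqMeasure_lt_top {C : Set (EuclideanSpace ℝ (Fin N))} (hC : IsCompact C)
    (h0 : 0 ∉ C) : invSqMeasure N C < ⊤ := by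
  rw [invSqMeasure, withDensity_apply _ hC.measurableSet]
  have hc : ContinuousOn (fun x : EuclideanSpace ℝ (Fin N) => (‖x‖ ^ 2)⁻¹) C := by
    refine ContinuousOn.inv₀ (by fun_prop) fun x hx => ?_
    have : x ≠ 0 := fun h => h0 (h ▸ hx)
    positivity
  exact (hc.integrableOn_compact hC).lintegral_lt_top

theorem integrableOn_of_memLp {C : Set (EuclideanSpace ℝ (Fin N))} (hC : IsCompact C)
    (h0 : 0 ∉ C) (w : L2Space N) : IntegrableOn w C (invSqMeasure N) := by
  have hfm : IsFiniteMeasure ((invSqMeasure N).restrict C) :=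
    ⟨by rw [Measure.restrict_apply_univ]; exact invSqMeasure_lt_top hC h0⟩
  exact ((Lp.memLp w).mono_measure Measure.restrict_le_self).integrable (by norm_num)

theorem invSqMeasure_absolutelyContinuous : invSqMeasure N ≪ volume :=
  withDensity_absolutelyContinuous _ _

/-- A vector `w` orthogonal to the domain annihilates every test function `g` on the punctured
space: uniform approximation within a fixed compact set `C` costs at most `ε ∫_C |w|`, and `w` is
integrable on `C`. -/
theorem denseRange_toL2 (hN : 1 ≤ N) : DenseRange (toL2 N) := by
  have : Nonempty (Fin N) := ⟨⟨0, hN⟩⟩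
  change Dense ((LinearMap.range (toL2 N) : Submodule ℂ (L2Space N)) : Set (L2Space N))
  rw [Submodule.dense_iff_topologicalClosure_eq_top, Submodule.topologicalClosure_eq_top_iff,
    Submodule.eq_bot_iff]
  intro w hw
  have hw1 : ∀ F (hF : F ∈ testDomain N), ∫ x, (starRingEnd ℂ) (F x) * w x ∂(invSqMeasure N) = 0 := by
    intro F hF
    have h1 := (Submodule.mem_orthogonal _ _).mp hw (toL2 N ⟨F, hF⟩) ⟨_, rfl⟩
    rw [L2.inner_def] at h1
    rw [← h1]
    refine integral_congr_ae ?_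
    filter_upwards [(memLp_of_mem hF).coeFn_toLp] with x hx
    change _ = ⟪(memLp_of_mem hF).toLp F x, w x⟫_ℂ
    rw [hx, RCLike.inner_apply, mul_comm]
  have h0 : ∀ᵐ x ∂(invSqMeasure N), x ≠ 0 := by
    refine invSqMeasure_absolutelyContinuous.ae_le ?_
    exact Measure.ae_ne _ _
  have hae : ∀ᵐ x ∂(invSqMeasure N), x ∈ ({0}ᶜ : Set (EuclideanSpace ℝ (Fin N))) → w x = 0 := by
    refine isOpen_compl_singleton.ae_eq_zero_of_integral_contDiff_smul_eq_zero ?_ ?_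
    · rw [locallyIntegrableOn_iff isOpen_compl_singleton.isLocallyClosed]
      intro C hC0 hC
      exact integrableOn_of_memLp hC (fun h => hC0 h rfl) w
    · intro g hg1 hg2 hg3
      have hsupp : tsupport (fun x => ((g x : ℝ) : ℂ)) ⊆ tsupport g :=
        tsupport_comp_subset (g := Complex.ofReal) Complex.ofReal_zero g
      obtain ⟨C, hC, hC0, hCs, hF⟩ := exists_testDomain_approx hN
        (G := fun x => ((g x : ℝ) : ℂ)) (by have := hg1.continuous; fun_prop)
        (hg2.of_isClosed_subset (isClosed_tsupport _) hsupp) (fun h => hg3 (hsupp h) rfl)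
      have hint := integrableOn_of_memLp hC hC0 w
      have hle : ∀ ε : ℝ, 0 < ε → ‖∫ x, g x • w x ∂(invSqMeasure N)‖ ≤
          ε * ∫ x in C, ‖w x‖ ∂(invSqMeasure N) := by
        intro ε hε
        obtain ⟨F, hF1, hF2, hF3⟩ := hF ε hε
        have hFc : Continuous F := (testDomain_le N hF1).1.continuous
        have hzero : ∀ x ∉ C, g x = 0 := fun x hx => by
          have : ((g x : ℝ) : ℂ) = 0 :=
            image_eq_zero_of_notMem_tsupport (f := fun x => ((g x : ℝ) : ℂ)) fun h => hx (hCs h)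
          exact_mod_cast this
        have e1 : ∫ x, g x • w x ∂(invSqMeasure N) =
            ∫ x in C, g x • w x ∂(invSqMeasure N) :=
          (setIntegral_eq_integral_of_forall_compl_eq_zero fun x hx => by
            rw [hzero x hx, zero_smul]).symm
        have e2 : ∫ x in C, (starRingEnd ℂ) (F x) * w x ∂(invSqMeasure N) = 0 := by
          rw [setIntegral_eq_integral_of_forall_compl_eq_zero fun x hx => by
            rw [hF3 x hx, map_zero, zero_mul]]
          exact hw1 F hF1
        have i1 : IntegrableOn (fun x => g x • w x) C (invSqMeasure N) := by
          have := hg1.continuous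
          exact hint.continuousOn_smul (by fun_prop) hC
        have i2 : IntegrableOn (fun x => (starRingEnd ℂ) (F x) * w x) C (invSqMeasure N) :=
          hint.continuousOn_mul (Complex.continuous_conj.comp hFc).continuousOn hC
        rw [e1, ← sub_zero (∫ x in C, g x • w x ∂(invSqMeasure N)), ← e2, ← integral_sub i1 i2,
          ← integral_const_mul]
        refine norm_integral_le_of_norm_le (hint.norm.const_mul ε) (ae_of_all _ fun x => ?_)
        rw [Complex.real_smul, ← sub_mul, norm_mul]
        refine mul_le_mul_of_nonneg_right ?_ (norm_nonneg _)
        rw [← Complex.conj_ofReal, ← map_sub, RCLike.norm_conj, norm_sub_rev]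
        exact hF2 x
      rw [← norm_le_zero_iff]
      refine le_of_forall_pos_le_add fun δ hδ => ?_
      have hI : 0 ≤ ∫ x in C, ‖w x‖ ∂(invSqMeasure N) := integral_nonneg fun x => norm_nonneg _
      refine (hle (δ / (∫ x in C, ‖w x‖ ∂(invSqMeasure N) + 1)) (by positivity)).trans ?_
      rw [zero_add, div_mul_eq_mul_div, div_le_iff₀ (by positivity)]
      nlinarith
  refine (Lp.eq_zero_iff_ae_eq_zero).mpr ?_
  filter_upwards [hae, h0] with x h1 h2
  exact h1 h2

end Density

/-! ### The angular Hilbert space -/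

section Angular

variable {N : ℕ}

/-- The surface measure of the unit sphere. -/
abbrev sphereMeasure (N : ℕ) : Measure (Metric.sphere (0 : EuclideanSpace ℝ (Fin N)) 1) :=
  (volume : Measure (EuclideanSpace ℝ (Fin N))).toSphere

theorem continuous_of_mem_sphericalHarmonics
    {p : Metric.sphere (0 : EuclideanSpace ℝ (Fin N)) 1 → ℂ} (hp : p ∈ sphericalHarmonics N) :
    Continuous p := by
  obtain ⟨P, rfl⟩ := exists_poly_of_mem hp
  refine (MvPolynomial.continuous_eval P).comp ?_
  fun_prop

theorem memLp_of_mem_sphericalHarmonics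
    {p : Metric.sphere (0 : EuclideanSpace ℝ (Fin N)) 1 → ℂ} (hp : p ∈ sphericalHarmonics N) :
    MemLp p 2 (sphereMeasure N) := by
  have hc := continuous_of_mem_sphericalHarmonics hp
  obtain ⟨C, hC⟩ := isCompact_univ.exists_bound_of_continuousOn hc.continuousOn
  exact MemLp.of_bound hc.aestronglyMeasurable C (ae_of_all _ fun x => hC x (Set.mem_univ x))

/-- The inclusion of the spherical harmonics in `L²` of the sphere. -/
def harmonicToLp (N : ℕ) : sphericalHarmonics N →ₗ[ℂ] Lp ℂ 2 (sphereMeasure N) where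
  toFun p := (memLp_of_mem_sphericalHarmonics p.2).toLp
    (p : Metric.sphere (0 : EuclideanSpace ℝ (Fin N)) 1 → ℂ)
  map_add' _ _ := rfl
  map_smul' _ _ := rfl

/-- The closure of the spherical harmonics in `L²` of the sphere. -/
def AngularSpace (N : ℕ) : Type := (LinearMap.range (harmonicToLp N)).topologicalClosure

instance : NormedAddCommGroup (AngularSpace N) :=
  inferInstanceAs (NormedAddCommGroup (LinearMap.range (harmonicToLp N)).topologicalClosure)

instance : InnerProductSpace ℂ (AngularSpace N) :=
  inferInstanceAs (InnerProductSpace ℂ (LinearMap.range (harmonicToLp N)).topologicalClosure)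

instance : CompleteSpace (AngularSpace N) :=
  inferInstanceAs (CompleteSpace (LinearMap.range (harmonicToLp N)).topologicalClosure)

/-- The inclusion of the spherical harmonics in the angular Hilbert space. -/
def toAngular (N : ℕ) : sphericalHarmonics N →ₗ[ℂ] AngularSpace N :=
  LinearMap.codRestrict (LinearMap.range (harmonicToLp N)).topologicalClosure (harmonicToLp N)
    fun p => Submodule.le_topologicalClosure _ ⟨p, rfl⟩

theorem denseRange_codRestrict_topologicalClosure {M V : Type*} [AddCommGroup M] [Module ℂ M]
    [NormedAddCommGroup V] [NormedSpace ℂ V] (f : M →ₗ[ℂ] V) :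
    DenseRange (f.codRestrict (LinearMap.range f).topologicalClosure
      fun p => Submodule.le_topologicalClosure _ ⟨p, rfl⟩) := by
  refine Topology.IsInducing.subtypeVal.dense_iff.mpr fun x => ?_
  rw [← Set.range_comp]
  exact x.2

theorem denseRange_toAngular : DenseRange (toAngular N) :=
  denseRange_codRestrict_topologicalClosure (harmonicToLp N)

theorem enorm_toLp_sq {α F : Type*} [MeasurableSpace α] {μ : Measure α} [NormedAddCommGroup F]
    {f : α → F} (hf : MemLp f 2 μ) : ‖hf.toLp‖ₑ ^ (2 : ℝ) = ∫⁻ x, ‖f x‖ₑ ^ (2 : ℝ) ∂μ := by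
  rw [Lp.enorm_toLp]
  exact eLpNorm_nnreal_pow_eq_lintegral (p := 2) two_ne_zero

theorem enorm_toAngular_sq (p : sphericalHarmonics N) :
    ‖toAngular N p‖ₑ ^ (2 : ℝ) = ∫⁻ w, ‖p.1 w‖ₑ ^ (2 : ℝ) ∂(sphereMeasure N) :=
  enorm_toLp_sq (memLp_of_mem_sphericalHarmonics p.2)

end Angular

/-! ### Logarithmic polar coordinates on the domain -/

section LogPolar

variable {N : ℕ}

theorem sphTensor_mem_testDomain {p : Metric.sphere (0 : EuclideanSpace ℝ (Fin N)) 1 → ℂ}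
    (hp : p ∈ sphericalHarmonics N) {f : ℝ → ℂ} (hf : IsRadialTest f) :
    sphTensor p f ∈ testDomain N :=
  Submodule.subset_span ⟨p, hp, f, hf, rfl⟩

theorem testDomain_induction {P : testDomain N → Prop}
    (hgen : ∀ (p : sphericalHarmonics N) (f : ℝ → ℂ) (hf : IsRadialTest f),
      P ⟨sphTensor p f, sphTensor_mem_testDomain p.2 hf⟩)
    (hzero : P 0) (hadd : ∀ F G, P F → P G → P (F + G)) (hsmul : ∀ (c : ℂ) F, P F → P (c • F))
    (F : testDomain N) : P F := by
  obtain ⟨F, hF⟩ := F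
  refine Submodule.span_induction (p := fun F hF => P ⟨F, hF⟩) ?_ hzero
    (fun F G hF hG h1 h2 => hadd ⟨F, hF⟩ ⟨G, hG⟩ h1 h2) (fun c F hF h => hsmul c ⟨F, hF⟩ h) hF
  rintro _ ⟨p, hp, f, hf, rfl⟩
  exact hgen ⟨p, hp⟩ f hf

theorem sphTensor_smul_sphere (p : Metric.sphere (0 : EuclideanSpace ℝ (Fin N)) 1 → ℂ) (f : ℝ → ℂ)
    {r : ℝ} (hr : 0 < r) (w : Metric.sphere (0 : EuclideanSpace ℝ (Fin N)) 1) :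
    sphTensor p f (r • (w : EuclideanSpace ℝ (Fin N))) = p w * f r := by
  have hw : ‖(w : EuclideanSpace ℝ (Fin N))‖ = 1 := norm_eq_of_mem_sphere w
  have hn : ‖r • (w : EuclideanSpace ℝ (Fin N))‖ = r := by
    rw [norm_smul, hw, mul_one, Real.norm_eq_abs, abs_of_pos hr]
  have h0 : r • (w : EuclideanSpace ℝ (Fin N)) ≠ 0 := by
    rw [← norm_ne_zero_iff, hn]; exact hr.ne'
  rw [sphTensor, dif_pos h0]
  congr 2
  · refine Subtype.ext ?_
    change ‖r • (w : EuclideanSpace ℝ (Fin N))‖⁻¹ • r • (w : EuclideanSpace ℝ (Fin N)) = _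
    rw [hn, smul_smul, inv_mul_cancel₀ hr.ne', one_smul]

theorem slice_mem (F : testDomain N) {r : ℝ} (hr : 0 < r) :
    (fun w : Metric.sphere (0 : EuclideanSpace ℝ (Fin N)) 1 =>
      F.1 (r • (w : EuclideanSpace ℝ (Fin N)))) ∈ sphericalHarmonics N := by
  refine testDomain_induction (P := fun F => (fun w : Metric.sphere (0 : EuclideanSpace ℝ (Fin N)) 1
    => F.1 (r • (w : EuclideanSpace ℝ (Fin N)))) ∈ sphericalHarmonics N) ?_ ?_ ?_ ?_ F
  · intro p f hf
    simp only [sphTensor_smul_sphere _ _ hr]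
    have := Submodule.smul_mem _ (f r) p.2
    convert! this using 1
    funext w
    rw [Pi.smul_apply, smul_eq_mul, mul_comm]
  · exact Submodule.zero_mem _
  · exact fun F G h1 h2 => Submodule.add_mem _ h1 h2
  · exact fun c F h => Submodule.smul_mem _ c h

/-- The restriction to the sphere of radius `exp (2 s)` of a function in the domain. -/
def slice (s : ℝ) : testDomain N →ₗ[ℂ] sphericalHarmonics N where
  toFun F := ⟨_, slice_mem F (Real.exp_pos (2 * s))⟩
  map_add' _ _ := rfl
  map_smul' _ _ := rfl

theorem slice_apply (s : ℝ) (F : testDomain N)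
    (w : Metric.sphere (0 : EuclideanSpace ℝ (Fin N)) 1) :
    (slice s F).1 w = F.1 (Real.exp (2 * s) • (w : EuclideanSpace ℝ (Fin N))) := rfl

/-- The square root of the density of `|x|⁻² dx` in logarithmic polar coordinates. -/
def logWeight (N : ℕ) (s : ℝ) : ℝ := √2 * Real.exp (((N : ℝ) - 2) * s)

/-- The function `s ↦ √2 exp ((N - 2) s) F (exp (2 s) ·)` with values in the angular space. -/
def logPolar (F : testDomain N) (s : ℝ) : AngularSpace N :=
  (logWeight N s : ℂ) • toAngular N (slice s F)

theorem logPolar_add (F G : testDomain N) : logPolar (F + G) = logPolar F + logPolar G := by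
  funext s
  simp [logPolar]

theorem logPolar_smul (c : ℂ) (F : testDomain N) : logPolar (c • F) = c • logPolar F := by
  funext s
  simp only [logPolar, map_smul, Pi.smul_apply]
  rw [smul_comm]

theorem logPolar_zero : logPolar (0 : testDomain N) = 0 := by
  funext s
  simp [logPolar]

theorem logPolar_sphTensor (p : sphericalHarmonics N) {f : ℝ → ℂ} (hf : IsRadialTest f) (s : ℝ) :
    logPolar ⟨sphTensor p f, sphTensor_mem_testDomain p.2 hf⟩ s =
      ((logWeight N s : ℂ) * f (Real.exp (2 * s))) • toAngular N p := by
  have h : slice s ⟨sphTensor p.1 f, sphTensor_mem_testDomain p.2 hf⟩ = f (Real.exp (2 * s)) • p := by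
    refine Subtype.ext (funext fun w => ?_)
    exact (sphTensor_smul_sphere _ _ (Real.exp_pos _) w).trans (mul_comm _ _)
  rw [logPolar, h, map_smul, mul_smul]

theorem contDiff_logWeight : ContDiff ℝ ∞ fun s => (logWeight N s : ℂ) := by
  have h : ContDiff ℝ ∞ fun s : ℝ => √2 * Real.exp (((N : ℝ) - 2) * s) := by fun_prop
  exact Complex.ofRealCLM.contDiff.comp h

theorem hasCompactSupport_comp_exp {f : ℝ → ℂ} (hf : IsRadialTest f) :
    HasCompactSupport fun s => f (Real.exp (2 * s)) := by
  have h1 : IsCompact ((fun r => Real.log r / 2) '' tsupport f) := by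
    refine hf.2.1.isCompact.image_of_continuousOn ?_
    exact (Real.continuousOn_log.mono fun r hr => (hf.2.2 hr).ne').div_const 2
  refine HasCompactSupport.intro h1 fun s hs => ?_
  refine image_eq_zero_of_notMem_tsupport fun h => hs ⟨_, h, ?_⟩
  simp only [Real.log_exp]
  ring

/-- On generators `logPolar` is a scalar test function times a fixed vector. The image lies in the
Schwartz space, where the Fourier transform is given by its integral. -/
theorem logPolar_smooth (F : testDomain N) :
    ContDiff ℝ ∞ (logPolar F) ∧ HasCompactSupport (logPolar F) := by
  refine testDomain_induction (P := fun F => ContDiff ℝ ∞ (logPolar F) ∧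
    HasCompactSupport (logPolar F)) ?_ ?_ ?_ ?_ F
  · intro p f hf
    have h1 : logPolar ⟨sphTensor p f, sphTensor_mem_testDomain p.2 hf⟩ =
        fun s => ((logWeight N s : ℂ) * f (Real.exp (2 * s))) • toAngular N p :=
      funext (logPolar_sphTensor p hf)
    rw [h1]
    refine ⟨(contDiff_logWeight.mul (hf.1.comp (by fun_prop))).smul contDiff_const, ?_⟩
    exact ((hasCompactSupport_comp_exp hf).mul_left).smul_right
  · rw [logPolar_zero]
    exact ⟨contDiff_const, HasCompactSupport.zero⟩
  · intro F G h1 h2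
    rw [logPolar_add]
    exact ⟨h1.1.add h2.1, h1.2.add h2.2⟩
  · intro c F h
    rw [logPolar_smul]
    exact ⟨h.1.const_smul c, h.2.smul_left (f := fun _ => c)⟩

/-- `logPolar` with values in the Schwartz space. -/
def logPolarSchwartz (N : ℕ) : testDomain N →ₗ[ℂ] SchwartzMap ℝ (AngularSpace N) where
  toFun F := (logPolar_smooth F).2.toSchwartzMap (logPolar_smooth F).1
  map_add' F G := by
    ext s
    exact congrFun (logPolar_add F G) s
  map_smul' c F := by
    ext s
    exact congrFun (logPolar_smul c F) s

theorem logPolarSchwartz_apply (F : testDomain N) (s : ℝ) :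
    logPolarSchwartz N F s = logPolar F s := rfl

theorem logPolarSchwartz_coe (F : testDomain N) :
    (logPolarSchwartz N F : ℝ → AngularSpace N) = logPolar F := rfl

/-! ### Scaling and the Euler operator on the domain -/

theorem IsRadialTest.const_mul_comp_mul {f : ℝ → ℂ} (hf : IsRadialTest f) (c : ℂ) {a : ℝ}
    (ha : 0 < a) : IsRadialTest fun r => c * f (a * r) := by
  have h1 : tsupport (fun r => c * f (a * r)) ⊆ (fun r => a * r) ⁻¹' tsupport f := by
    refine closure_minimal (fun r hr => ?_) ((isClosed_tsupport f).preimage (by fun_prop))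
    refine subset_tsupport f fun h => hr ?_
    simp only [h, mul_zero]
  refine ⟨contDiff_const.mul (hf.1.comp (by fun_prop)), ?_, fun r hr => ?_⟩
  · exact HasCompactSupport.mul_left
      (hf.2.1.comp_homeomorph (Homeomorph.mulLeft₀ a ha.ne'))
  · have := hf.2.2 (h1 hr)
    exact pos_of_mul_pos_right (Set.mem_Ioi.mp this) ha.le

/-- Dilation fixes `ω` and only rescales the radial factor; this is the invariance used in Nelson's
criterion. -/
theorem scale_mem (t : ℝ) (F : testDomain N) :
    (fun x => (Real.exp (((N : ℝ) - 2) * t) : ℂ) * F.1 (Real.exp (2 * t) • x)) ∈ testDomain N := by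
  refine testDomain_induction (P := fun F => (fun x => (Real.exp (((N : ℝ) - 2) * t) : ℂ) *
    F.1 (Real.exp (2 * t) • x)) ∈ testDomain N) ?_ ?_ ?_ ?_ F
  · intro p f hf
    have h1 := hf.const_mul_comp_mul (Real.exp (((N : ℝ) - 2) * t) : ℂ) (Real.exp_pos (2 * t))
    convert! sphTensor_mem_testDomain p.2 h1 using 1
    funext x
    by_cases hx : x = 0
    · subst hx
      simp [sphTensor]
    · have h2 : Real.exp (2 * t) • x = (Real.exp (2 * t) * ‖x‖) • (‖x‖⁻¹ • x) := by
        rw [smul_smul, mul_assoc, mul_inv_cancel₀ (norm_ne_zero_iff.mpr hx), mul_one]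
      have h3 : ‖x‖⁻¹ • x ∈ Metric.sphere (0 : EuclideanSpace ℝ (Fin N)) 1 := by
        rw [mem_sphere_zero_iff_norm]; exact norm_smul_inv_norm (𝕜 := ℝ) hx
      have h4 : x = ‖x‖ • (‖x‖⁻¹ • x) := by
        rw [smul_smul, mul_inv_cancel₀ (norm_ne_zero_iff.mpr hx), one_smul]
      have h5 : 0 < ‖x‖ := norm_pos_iff.mpr hx
      have h6 := sphTensor_smul_sphere p.1 f (r := Real.exp (2 * t) * ‖x‖) (by positivity) ⟨_, h3⟩
      have h7 := sphTensor_smul_sphere p.1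
        (fun r => (Real.exp (((N : ℝ) - 2) * t) : ℂ) * f (Real.exp (2 * t) * r)) h5 ⟨_, h3⟩
      simp only [← h2, ← h4] at h6 h7
      refine (congrArg _ h6).trans (Eq.trans ?_ h7.symm)
      ring
  · convert! Submodule.zero_mem (testDomain N) using 1
    funext x
    simp
  · intro F G h1 h2
    convert! Submodule.add_mem _ h1 h2 using 1
    funext x
    simp [mul_add]
  · intro c F h
    convert! Submodule.smul_mem _ c h using 1
    funext x
    simp [mul_left_comm]

/-- The action of the scaling group on the domain. -/
def scaleTest (t : ℝ) (F : testDomain N) : testDomain N := ⟨_, scale_mem t F⟩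

theorem scaleTest_apply (t : ℝ) (F : testDomain N) (x : EuclideanSpace ℝ (Fin N)) :
    (scaleTest t F).1 x = (Real.exp (((N : ℝ) - 2) * t) : ℂ) * F.1 (Real.exp (2 * t) • x) := rfl

/-- The factor `e^{(N-2)t}` is exactly what moves the weight from `s` to `s + t`. -/
theorem logPolar_scaleTest (t : ℝ) (F : testDomain N) (s : ℝ) :
    logPolar (scaleTest t F) s = logPolar F (s + t) := by
  have h1 : slice s (scaleTest t F) =
      (Real.exp (((N : ℝ) - 2) * t) : ℂ) • slice (s + t) F := by
    refine Subtype.ext (funext fun w => ?_)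
    change _ = (Real.exp (((N : ℝ) - 2) * t) : ℂ) * (slice (s + t) F).1 w
    rw [slice_apply, slice_apply, scaleTest_apply, smul_smul, ← Real.exp_add]
    rw [show 2 * t + 2 * s = 2 * (s + t) by ring]
  rw [logPolar, logPolar, h1, map_smul, smul_smul, ← Complex.ofReal_mul]
  congr 2
  rw [logWeight, logWeight, mul_assoc, ← Real.exp_add]
  congr 3
  ring

theorem sum_mul_fderiv {F : EuclideanSpace ℝ (Fin N) → ℂ} (x : EuclideanSpace ℝ (Fin N)) :
    ∑ j, ((x j : ℝ) : ℂ) * fderiv ℝ F x (EuclideanSpace.single j 1) = fderiv ℝ F x x := by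
  have h := (EuclideanSpace.basisFun (Fin N) ℝ).sum_repr x
  simp only [EuclideanSpace.basisFun_repr, EuclideanSpace.basisFun_apply] at h
  conv_rhs => arg 2; rw [← h]
  rw [map_sum]
  refine Finset.sum_congr rfl fun j _ => ?_
  rw [map_smul, Complex.real_smul]

theorem eulerExpr_add {F G : EuclideanSpace ℝ (Fin N) → ℂ} (hF : Differentiable ℝ F)
    (hG : Differentiable ℝ G) : eulerExpr (F + G) = eulerExpr F + eulerExpr G := by
  funext x
  simp only [eulerExpr, sum_mul_fderiv, Pi.add_apply]
  rw [fderiv_add (hF x) (hG x), add_apply]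
  ring

theorem eulerExpr_smul (c : ℂ) {F : EuclideanSpace ℝ (Fin N) → ℂ} (hF : Differentiable ℝ F) :
    eulerExpr (c • F) = c • eulerExpr F := by
  funext x
  simp only [eulerExpr, sum_mul_fderiv, Pi.smul_apply, smul_eq_mul]
  rw [fderiv_const_smul (hF x), smul_apply, smul_eq_mul]
  ring

theorem testDomain_differentiable (F : testDomain N) : Differentiable ℝ F.1 :=
  (testDomain_le N F.2).1.differentiable (by simp)

/-- The radial part of the Euler operator. -/
def radialEuler (N : ℕ) (f : ℝ → ℂ) (r : ℝ) : ℂ := 2 * (r * deriv f r) + ((N : ℂ) - 2) * f r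

theorem IsRadialTest.radialEuler {f : ℝ → ℂ} (hf : IsRadialTest f) :
    IsRadialTest (radialEuler N f) := by
  have h1 : tsupport (ScalingGroup.radialEuler N f) ⊆ tsupport f := by
    refine closure_minimal (fun r hr => ?_) (isClosed_tsupport f)
    by_contra h
    refine hr ?_
    have h2 : f =ᶠ[𝓝 r] 0 := notMem_tsupport_iff_eventuallyEq.mp h
    rw [ScalingGroup.radialEuler, h2.deriv_eq, h2.eq_of_nhds]
    simp
  refine ⟨?_, hf.2.1.of_isClosed_subset (isClosed_tsupport _) h1, h1.trans hf.2.2⟩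
  have h2 : ContDiff ℝ ∞ (deriv f) := (contDiff_infty_iff_deriv.mp hf.1).2
  exact (contDiff_const.mul (Complex.ofRealCLM.contDiff.mul h2)).add (contDiff_const.mul hf.1)

theorem eulerExpr_sphTensor (p : sphericalHarmonics N) {f : ℝ → ℂ} (hf : IsRadialTest f) :
    eulerExpr (sphTensor p.1 f) = sphTensor p.1 (radialEuler N f) := by
  funext x
  rw [eulerExpr, sum_mul_fderiv]
  by_cases hx : x = 0
  · subst hx
    simp [sphTensor]
  · have h3 : ‖x‖⁻¹ • x ∈ Metric.sphere (0 : EuclideanSpace ℝ (Fin N)) 1 := by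
      rw [mem_sphere_zero_iff_norm]; exact norm_smul_inv_norm (𝕜 := ℝ) hx
    have h4 : x = ‖x‖ • (‖x‖⁻¹ • x) := by
      rw [smul_smul, mul_inv_cancel₀ (norm_ne_zero_iff.mpr hx), one_smul]
    have h5 : 0 < ‖x‖ := norm_pos_iff.mpr hx
    have h6 : ∀ (g : ℝ → ℂ) (t : ℝ), 0 < t →
        sphTensor p.1 g (t • x) = p.1 ⟨_, h3⟩ * g (t * ‖x‖) := fun g t ht => by
      conv_lhs => rw [h4, smul_smul]
      exact sphTensor_smul_sphere p.1 g (by positivity) ⟨_, h3⟩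
    have h7 : ∀ g : ℝ → ℂ, sphTensor p.1 g x = p.1 ⟨_, h3⟩ * g ‖x‖ := fun g => by
      have := h6 g 1 one_pos
      rwa [one_smul, one_mul] at this
    -- The Euler field is the derivative along the ray `t ↦ tx` at `t = 1`, computed by the chain
    -- rule and again from the product form.
    have d1 : HasDerivAt (fun t : ℝ => sphTensor p.1 f (t • x)) (fderiv ℝ (sphTensor p.1 f) x x) 1 := by
      have e1 : HasFDerivAt (sphTensor p.1 f) (fderiv ℝ (sphTensor p.1 f) x) ((1 : ℝ) • x) := by
        rw [one_smul]
        exact (testDomain_differentiable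
          ⟨_, sphTensor_mem_testDomain p.2 hf⟩ x).hasFDerivAt
      have e2 : HasDerivAt (fun t : ℝ => t • x) x 1 := by
        simpa using (hasDerivAt_id (1 : ℝ)).smul_const x
      exact e1.comp_hasDerivAt (1 : ℝ) e2
    have d2 : HasDerivAt (fun t : ℝ => sphTensor p.1 f (t • x))
        (p.1 ⟨_, h3⟩ * (‖x‖ * deriv f ‖x‖)) 1 := by
      have e1 : HasDerivAt f (deriv f ‖x‖) (1 * ‖x‖) := by
        rw [one_mul]
        exact ((contDiff_infty_iff_deriv.mp hf.1).1 _).hasDerivAt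
      have e2 : HasDerivAt (fun t : ℝ => t * ‖x‖) ‖x‖ 1 := by
        simpa using (hasDerivAt_id (1 : ℝ)).mul_const ‖x‖
      have e3 := (e1.scomp (1 : ℝ) e2).const_mul (p.1 ⟨_, h3⟩)
      rw [Complex.real_smul] at e3
      refine e3.congr_of_eventuallyEq ?_
      filter_upwards [lt_mem_nhds (zero_lt_one : (0 : ℝ) < 1)] with t ht
      exact h6 f t ht
    rw [d1.unique d2, h7, h7, radialEuler]
    ring

theorem hasDerivAt_logWeight (s : ℝ) :
    HasDerivAt (fun s => (logWeight N s : ℂ)) (((N : ℂ) - 2) * logWeight N s) s := by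
  have h1 : HasDerivAt (logWeight N) (((N : ℝ) - 2) * logWeight N s) s := by
    have := (((hasDerivAt_id s).const_mul ((N : ℝ) - 2)).exp).const_mul √2
    convert! this using 1
    simp [logWeight]
    ring
  convert! h1.ofReal_comp using 1
  push_cast
  ring

/-- The weight contributes `N - 2` and `r = e^{2s}` contributes `2r d/dr`. Both claims go through
one induction, since the derivative is expressed through the membership. -/
theorem eulerExpr_mem_and_hasDerivAt (F : testDomain N) :
    ∃ h : eulerExpr F.1 ∈ testDomain N,
      ∀ s, HasDerivAt (logPolar F) (logPolar ⟨eulerExpr F.1, h⟩ s) s := by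
  refine testDomain_induction (P := fun F => ∃ h : eulerExpr F.1 ∈ testDomain N,
    ∀ s, HasDerivAt (logPolar F) (logPolar ⟨eulerExpr F.1, h⟩ s) s) ?_ ?_ ?_ ?_ F
  · intro p f hf
    have h1 := eulerExpr_sphTensor p hf
    refine ⟨h1 ▸ sphTensor_mem_testDomain p.2 hf.radialEuler, fun s => ?_⟩
    simp only [h1]
    rw [logPolar_sphTensor p hf.radialEuler]
    refine HasDerivAt.congr_of_eventuallyEq ?_
      (Eventually.of_forall fun s => logPolar_sphTensor p hf s)
    have e1 : HasDerivAt f (deriv f (Real.exp (2 * s))) (Real.exp (2 * s)) :=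
      ((contDiff_infty_iff_deriv.mp hf.1).1 _).hasDerivAt
    have e2 : HasDerivAt (fun s : ℝ => Real.exp (2 * s)) (Real.exp (2 * s) * 2) s := by
      simpa using ((hasDerivAt_id s).const_mul 2).exp
    have e3 := ((hasDerivAt_logWeight (N := N) s).mul (e1.scomp s e2)).smul_const (toAngular N p)
    convert! e3 using 1
    congr 1
    rw [radialEuler, Complex.real_smul]
    simp only [Function.comp]
    push_cast
    ring
  · have h1 : eulerExpr ((0 : testDomain N).1) = 0 := by
      funext x
      simp [eulerExpr]
    refine ⟨h1 ▸ Submodule.zero_mem _, fun s => ?_⟩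
    simp only [h1]
    rw [logPolar_zero]
    have h2 : (⟨0, Submodule.zero_mem _⟩ : testDomain N) = 0 := rfl
    rw [h2, logPolar_zero]
    exact hasDerivAt_const s 0
  · rintro F G ⟨hF, dF⟩ ⟨hG, dG⟩
    have h1 : eulerExpr ((F + G : testDomain N).1) = eulerExpr F.1 + eulerExpr G.1 :=
      eulerExpr_add (testDomain_differentiable F) (testDomain_differentiable G)
    refine ⟨h1 ▸ Submodule.add_mem _ hF hG, fun s => ?_⟩
    simp only [h1]
    have h2 : (⟨eulerExpr F.1 + eulerExpr G.1, Submodule.add_mem _ hF hG⟩ : testDomain N) =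
      ⟨eulerExpr F.1, hF⟩ + ⟨eulerExpr G.1, hG⟩ := rfl
    rw [h2, logPolar_add, logPolar_add]
    exact (dF s).add (dG s)
  · rintro c F ⟨hF, dF⟩
    have h1 : eulerExpr ((c • F : testDomain N).1) = c • eulerExpr F.1 :=
      eulerExpr_smul c (testDomain_differentiable F)
    refine ⟨h1 ▸ Submodule.smul_mem _ c hF, fun s => ?_⟩
    simp only [h1]
    have h2 : (⟨c • eulerExpr F.1, Submodule.smul_mem _ c hF⟩ : testDomain N) =
      c • ⟨eulerExpr F.1, hF⟩ := rfl
    rw [h2, logPolar_smul, logPolar_smul]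
    exact (dF s).const_smul c

/-- The Euler operator as a map from the domain to itself. -/
def eulerTest (F : testDomain N) : testDomain N := ⟨_, (eulerExpr_mem_and_hasDerivAt F).1⟩

theorem hasDerivAt_logPolar (F : testDomain N) (s : ℝ) :
    HasDerivAt (logPolar F) (logPolar (eulerTest F) s) s :=
  (eulerExpr_mem_and_hasDerivAt F).2 s

end LogPolar

/-! ### Diagonalization of the scaling group -/

section Diagonalization

open FourierTransform

variable {N : ℕ}

/-- `logPolar` with values in `L²(ℝ)`. -/
def logPolarToLp (N : ℕ) : testDomain N →ₗ[ℂ] Lp (α := ℝ) (AngularSpace N) 2 :=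
  (SchwartzMap.toLpCLM ℂ (E := ℝ) (AngularSpace N) 2 volume).toLinearMap ∘ₗ logPolarSchwartz N

theorem logPolarToLp_apply (F : testDomain N) :
    logPolarToLp N F = (logPolarSchwartz N F).toLp 2 := rfl

/-- The squared weight is the density `2e^{2(N-2)s}`. -/
theorem norm_logPolarToLp (hN : 1 ≤ N) (F : testDomain N) : ‖logPolarToLp N F‖ = ‖toL2 N F‖ := by
  have hFc : Continuous F.1 := (testDomain_le N F.2).1.continuous
  have h1 : ‖logPolarToLp N F‖ₑ ^ (2 : ℝ) = ∫⁻ s, ‖logPolar F s‖ₑ ^ (2 : ℝ) :=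
    enorm_toLp_sq ((logPolarSchwartz N F).memLp 2 volume)
  have h2 : ‖toL2 N F‖ₑ ^ (2 : ℝ) = ∫⁻ x, ‖F.1 x‖ₑ ^ (2 : ℝ) ∂(invSqMeasure N) :=
    enorm_toLp_sq (memLp_of_mem F.2)
  have h3 : ‖logPolarToLp N F‖ₑ ^ (2 : ℝ) = ‖toL2 N F‖ₑ ^ (2 : ℝ) := by
    rw [h1, h2, lintegral_invSqMeasure hN (by fun_prop)]
    refine lintegral_congr fun s => ?_
    rw [logPolar, enorm_smul, ENNReal.mul_rpow_of_nonneg _ _ (by norm_num), enorm_toAngular_sq]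
    congr 1
    rw [← ofReal_norm, Complex.norm_real, Real.norm_eq_abs, ENNReal.ofReal_rpow_of_nonneg
      (abs_nonneg _) (by norm_num), Real.rpow_two, sq_abs, logWeight, mul_pow,
      Real.sq_sqrt (by norm_num), ← Real.exp_nat_mul]
    congr 3
    push_cast
    ring
  have h4 := ENNReal.rpow_left_injective (two_ne_zero' ℝ) h3
  rw [← toReal_enorm, h4, toReal_enorm]

/-- Every smooth compactly supported function of the logarithm of the radius comes from a radial
test function. -/
theorem exists_isRadialTest (N : ℕ) {g : ℝ → ℝ} (hg1 : ContDiff ℝ ∞ g) (hg2 : HasCompactSupport g) :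
    ∃ f, IsRadialTest f ∧ ∀ s, (logWeight N s : ℂ) * f (Real.exp (2 * s)) = g s := by
  obtain ⟨R, hR⟩ := hg2.isBounded.subset_closedBall 0
  -- Undo `r = e^{2s}` and divide by the weight, which never vanishes.
  let f : ℝ → ℂ := fun r => if 0 < r then
    ((g (Real.log r / 2) / logWeight N (Real.log r / 2) : ℝ) : ℂ) else 0
  have hw : ∀ s, logWeight N s ≠ 0 := fun s => by unfold logWeight; positivity
  have hsupp : tsupport f ⊆ Set.Icc (Real.exp (-(2 * R))) (Real.exp (2 * R)) := by
    refine closure_minimal (fun r hr => ?_) isClosed_Icc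
    by_cases h0 : 0 < r
    · have h1 : g (Real.log r / 2) ≠ 0 := fun h => hr (by simp [f, h])
      have h2 := hR (subset_tsupport g h1)
      rw [mem_closedBall_zero_iff, Real.norm_eq_abs, abs_le] at h2
      rw [Set.mem_Icc, ← Real.le_log_iff_exp_le h0, ← Real.log_le_iff_le_exp h0]
      constructor <;> linarith [h2.1, h2.2]
    · exact absurd (by simp [f, h0]) hr
  refine ⟨f, ⟨?_, isCompact_Icc.of_isClosed_subset (isClosed_tsupport f) hsupp, fun r hr =>
    (Real.exp_pos _).trans_le (hsupp hr).1⟩, fun s => ?_⟩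
  · rw [contDiff_iff_contDiffAt]
    intro r
    by_cases h0 : 0 < r
    · have h1 : ContDiffAt ℝ ∞ (fun r => Real.log r / 2) r :=
        (Real.contDiffAt_log.mpr h0.ne').div_const 2
      have h2 : ContDiffAt ℝ ∞ (fun r => ((g (Real.log r / 2) / logWeight N (Real.log r / 2) : ℝ) : ℂ)) r := by
        have h3 : ContDiff ℝ ∞ (logWeight N) := by
          have : ContDiff ℝ ∞ fun s : ℝ => √2 * Real.exp (((N : ℝ) - 2) * s) := by fun_prop
          exact this
        exact Complex.ofRealCLM.contDiff.contDiffAt.comp r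
          ((hg1.contDiffAt.comp r h1).div (h3.contDiffAt.comp r h1) (hw _))
      refine h2.congr_of_eventuallyEq ?_
      filter_upwards [lt_mem_nhds h0] with y hy
      simp [f, hy]
    · have h1 : f =ᶠ[𝓝 r] 0 := notMem_tsupport_iff_eventuallyEq.mp fun h =>
        h0 ((Real.exp_pos _).trans_le (hsupp h).1)
      exact (contDiffAt_const (c := (0 : ℂ))).congr_of_eventuallyEq h1
  · have h1 : 2 * s / 2 = s := by ring
    simp only [f, Real.exp_pos, if_true, Real.log_exp, h1]
    rw [← Complex.ofReal_mul, mul_div_cancel₀ _ (hw s)]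

/-- If `u` is orthogonal to all products `g(s) p`, then `∫ g u` is orthogonal to the dense set of
harmonics, so it is zero for every test function `g`, and `u = 0`. -/
theorem denseRange_logPolarToLp : DenseRange (logPolarToLp N) := by
  change Dense ((LinearMap.range (logPolarToLp N) :
    Submodule ℂ (Lp (α := ℝ) (AngularSpace N) 2)) :
      Set (Lp (α := ℝ) (AngularSpace N) 2))
  rw [Submodule.dense_iff_topologicalClosure_eq_top, Submodule.topologicalClosure_eq_top_iff,
    Submodule.eq_bot_iff]
  intro u hu
  have hu1 : ∀ F : testDomain N, ∫ s, ⟪logPolar F s, u s⟫_ℂ = 0 := fun F => by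
    have h1 := (Submodule.mem_orthogonal _ _).mp hu (logPolarToLp N F) ⟨F, rfl⟩
    rw [L2.inner_def] at h1
    rw [← h1]
    refine integral_congr_ae ?_
    filter_upwards [(logPolarSchwartz N F).coeFn_toLp 2 volume] with s hs
    rw [logPolarToLp_apply, hs, logPolarSchwartz_apply]
  have hli : LocallyIntegrable u volume := (Lp.memLp u).locallyIntegrable (by norm_num)
  refine (Lp.eq_zero_iff_ae_eq_zero).mpr ?_
  refine ae_eq_zero_of_integral_contDiff_smul_eq_zero hli fun g hg1 hg2 => ?_
  obtain ⟨f, hf, hfg⟩ := exists_isRadialTest N hg1 hg2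
  have hint : Integrable (fun s => g s • u s) volume :=
    hli.integrable_smul_left_of_hasCompactSupport hg1.continuous hg2
  refine denseRange_toAngular.eq_zero_of_inner_right ℂ fun p => ?_
  rw [← integral_inner hint, ← hu1 ⟨sphTensor p f, sphTensor_mem_testDomain p.2 hf⟩]
  refine integral_congr_ae (ae_of_all _ fun s => ?_)
  simp only
  rw [logPolar_sphTensor p hf, hfg, inner_smul_left, Complex.conj_ofReal, ← Complex.coe_smul,
    inner_smul_right]

/-- The isometry from `L²(ℝ^N, |x|⁻² dx)` given by logarithmic polar coordinates. -/
def logPolarEquiv (hN : 1 ≤ N) : L2Space N ≃ₗᵢ[ℂ] Lp (α := ℝ) (AngularSpace N) 2 :=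
  (LinearEquiv.refl ℂ (testDomain N)).extendOfIsometry (toL2 N) (logPolarToLp N)
    (denseRange_toL2 hN) denseRange_logPolarToLp (norm_logPolarToLp hN)

theorem logPolarEquiv_toL2 (hN : 1 ≤ N) (F : testDomain N) :
    logPolarEquiv hN (toL2 N F) = logPolarToLp N F :=
  LinearEquiv.extendOfIsometry_eq _ _ _ _ _ _ _

/-- The unitary map that diagonalizes the scaling group. -/
def mellin (hN : 1 ≤ N) : L2Space N ≃ₗᵢ[ℂ] Lp (α := ℝ) (AngularSpace N) 2 :=
  (logPolarEquiv hN).trans (Lp.fourierTransformₗᵢ ℝ (AngularSpace N))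

theorem mellin_toL2 (hN : 1 ≤ N) (F : testDomain N) :
    mellin hN (toL2 N F) =ᵐ[volume] 𝓕 (logPolar F) := by
  have h : mellin hN (toL2 N F) = (𝓕 (logPolarSchwartz N F)).toLp 2 := by
    rw [← SchwartzMap.toLp_fourier_eq]
    change 𝓕 (logPolarEquiv hN (toL2 N F)) = _
    rw [logPolarEquiv_toL2, logPolarToLp_apply]
  rw [h]
  filter_upwards [(𝓕 (logPolarSchwartz N F)).coeFn_toLp 2 volume] with x hx
  rw [hx, SchwartzMap.fourier_coe, logPolarSchwartz_coe]

/-- The spectral parameter. -/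
def frequency (x : ℝ) : ℝ := 2 * Real.pi * x

theorem measurable_frequency : Measurable frequency := by
  unfold frequency; fun_prop

/-- The `2π` in `frequency` comes from the kernel `e^{-2πisx}`. -/
theorem fourier_comp_add {V : Type*} [NormedAddCommGroup V] [NormedSpace ℂ V] (u : ℝ → V) (t x : ℝ) :
    𝓕 (fun s => u (s + t)) x = Complex.exp (Complex.I * t * frequency x) • 𝓕 u x := by
  rw [Real.fourier_eq', Real.fourier_eq', ← integral_smul,
    ← integral_add_right_eq_self (fun s => _ • Complex.exp _ • u s) t]
  refine integral_congr_ae (ae_of_all _ fun s => ?_)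
  simp only
  rw [smul_smul, ← Complex.exp_add]
  congr 2
  simp [frequency]
  ring

theorem expOp_mellin_toL2 (hN : 1 ≤ N) (t : ℝ) (F : testDomain N) :
    expOp (mellin hN) measurable_frequency t (toL2 N F) = toL2 N (scaleTest t F) := by
  refine ext_of_ae (mellin hN) ?_
  filter_upwards [map_expOp (mellin hN) measurable_frequency t (toL2 N F), mellin_toL2 hN F,
    mellin_toL2 hN (scaleTest t F)] with x h1 h2 h3
  rw [h1, h2, h3, ← fourier_comp_add]
  have h4 : (fun s => logPolar F (s + t)) = logPolar (scaleTest t F) :=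
    funext fun s => (logPolar_scaleTest t F s).symm
  rw [h4]

theorem mellin_eulerTest (hN : 1 ≤ N) (F : testDomain N) :
    mellin hN (toL2 N (eulerTest F)) =ᵐ[volume]
      fun x => (Complex.I * frequency x) • mellin hN (toL2 N F) x := by
  have h1 : deriv (logPolar F) = logPolar (eulerTest F) :=
    funext fun s => (hasDerivAt_logPolar F s).deriv
  have h2 := Real.fourier_deriv (logPolarSchwartz N F).integrable
    (fun s => (hasDerivAt_logPolar F s).differentiableAt) (by
      rw [logPolarSchwartz_coe, h1]
      exact (logPolarSchwartz N (eulerTest F)).integrable)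
  rw [logPolarSchwartz_coe, h1] at h2
  filter_upwards [mellin_toL2 hN F, mellin_toL2 hN (eulerTest F)] with x h3 h4
  rw [h3, h4, h2]
  refine congrArg (· • 𝓕 (logPolar F) x) ?_
  simp only [frequency, Complex.ofReal_mul, Complex.ofReal_ofNat]
  ring1

theorem eulerOp_le_mulSkew (hN : 1 ≤ N) : eulerOp N ≤ mulSkew (mellin hN) frequency := by
  have h1 : ∀ F : testDomain N, toL2 N F ∈ (mulSkew (mellin hN) frequency).domain := fun F =>
    mem_mulSkew_domain_of_ae _ (mellin_eulerTest hN F)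
  refine ⟨?_, ?_⟩
  · rintro _ ⟨F, rfl⟩
    exact h1 F
  · rintro ⟨_, ⟨F, rfl⟩⟩ ⟨w, hw⟩ hvw
    obtain rfl : toL2 N F = w := hvw
    rw [mulSkew_eq_of_ae (mellin hN) (v := ⟨_, hw⟩) (mellin_eulerTest hN F)]
    change eulerToL2 N ((LinearEquiv.ofInjective (toL2 N) (toL2_injective N)).symm
      (LinearEquiv.ofInjective (toL2 N) (toL2_injective N) F)) = _
    rw [LinearEquiv.symm_apply_apply]
    rfl

theorem closure_eulerOp (hN : 1 ≤ N) :
    (eulerOp N).IsClosable ∧ (eulerOp N).closure = mulSkew (mellin hN) frequency := by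
  refine closure_eq_mulSkew _ measurable_frequency (eulerOp_le_mulSkew hN) (denseRange_toL2 hN) ?_
  rintro t _ ⟨F, rfl⟩
  rw [expOp_mellin_toL2]
  exact ⟨_, rfl⟩

/-! ### The scaling formula on the whole Hilbert space -/

theorem ae_comp_smul {P : EuclideanSpace ℝ (Fin N) → Prop} (h : ∀ᵐ x ∂(invSqMeasure N), P x)
    {a : ℝ} (ha : a ≠ 0) : ∀ᵐ x ∂(invSqMeasure N), P (a • x) := by
  rw [invSqMeasure, ae_withDensity_iff measurable_invSqDensity] at h ⊢
  have hq : Measure.QuasiMeasurePreserving (fun x : EuclideanSpace ℝ (Fin N) => a • x)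
      volume volume := by
    refine ⟨by fun_prop, ?_⟩
    rw [Measure.map_addHaar_smul volume ha]
    exact Measure.smul_absolutelyContinuous
  filter_upwards [hq.ae h] with x hx h0
  refine hx ?_
  rw [Ne, ENNReal.ofReal_eq_zero, not_le] at h0 ⊢
  -- At the origin the density is `0`, because `0⁻¹ = 0`.
  have h1 : ‖x‖ ≠ 0 := fun h => by simp [h] at h0
  rw [norm_smul]
  have : ‖a‖ ≠ 0 := norm_ne_zero_iff.mpr ha
  positivity

/-- The formula holds on the dense domain, and both sides pass to limits almost everywhere along a
subsequence, because dilations preserve null sets. -/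
theorem expOp_mellin_ae (hN : 1 ≤ N) (t : ℝ) (F : L2Space N) :
    expOp (mellin hN) measurable_frequency t F =ᵐ[invSqMeasure N]
      fun x => (Real.exp (((N : ℝ) - 2) * t) : ℂ) * F (Real.exp (2 * t) • x) := by
  have hF : F ∈ closure (Set.range (toL2 N)) := denseRange_toL2 hN F
  obtain ⟨v, hv, hvF⟩ := mem_closure_iff_seq_limit.mp hF
  choose G hG using hv
  obtain rfl : (fun n => toL2 N (G n)) = v := funext hG
  have hlim : ∀ {w : ℕ → L2Space N} {u : L2Space N}, Tendsto w atTop (𝓝 u) →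
      TendstoInMeasure (invSqMeasure N) (fun n => (w n : EuclideanSpace ℝ (Fin N) → ℂ)) atTop u :=
    fun h => tendstoInMeasure_of_tendsto_Lp h
  obtain ⟨n1, hn1, h1⟩ := (hlim hvF).exists_seq_tendsto_ae
  have h2 : Tendsto (fun k => expOp (mellin hN) measurable_frequency t (toL2 N (G (n1 k)))) atTop
      (𝓝 (expOp (mellin hN) measurable_frequency t F)) :=
    ((expOp (mellin hN) measurable_frequency t).continuous.tendsto F).comp
      (hvF.comp hn1.tendsto_atTop)
  -- A further subsequence makes the images converge almost everywhere too.
  obtain ⟨n2, hn2, h3⟩ := (hlim h2).exists_seq_tendsto_ae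
  have h4 := ae_comp_smul h1 (Real.exp_pos (2 * t)).ne'
  have h5 := ae_all_iff.mpr fun n => ae_comp_smul (memLp_of_mem (G n).2).coeFn_toLp
    (Real.exp_pos (2 * t)).ne'
  have h6 := ae_all_iff.mpr fun n => (memLp_of_mem (scaleTest t (G n)).2).coeFn_toLp
  filter_upwards [h3, h4, h5, h6] with x k3 k4 k5 k6
  refine tendsto_nhds_unique k3 ?_
  have k7 := ((k4.comp hn2.tendsto_atTop).const_mul (Real.exp (((N : ℝ) - 2) * t) : ℂ))
  refine k7.congr fun n => ?_
  rw [expOp_mellin_toL2]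
  refine Eq.trans ?_ (k6 _).symm
  rw [scaleTest_apply]
  exact congrArg _ (k5 _)

end Diagonalization

end ScalingGroup

end

/-! ### Assembly of the theorem -/

theorem mainTheorem4 (N : ℕ) (hN : 1 ≤ N) :
    ScalingGroup.IsEssentiallySkewAdjoint (ScalingGroup.eulerOp N) ∧
    (∃! E : ScalingGroup.ProjectionValuedMeasure (ScalingGroup.L2Space N),
      E.IsSpectralMeasureOf (Complex.I⁻¹ • (ScalingGroup.eulerOp N).closure)) ∧
    ∀ t : ℝ,
      ScalingGroup.expSkew (ScalingGroup.eulerOp N).closure t ∈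
        unitary (ScalingGroup.L2Space N →L[ℂ] ScalingGroup.L2Space N) ∧
      ∀ F : ScalingGroup.L2Space N,
        ScalingGroup.expSkew (ScalingGroup.eulerOp N).closure t F
          =ᵐ[ScalingGroup.invSqMeasure N]
            fun x => (Real.exp (((N : ℝ) - 2) * t) : ℂ) * F (Real.exp (2 * t) • x) := by
  open ScalingGroup in
  obtain ⟨h1, h2⟩ := closure_eulerOp hN
  have hd : Dense ((eulerOp N).domain : Set (L2Space N)) := denseRange_toL2 hN
  have hd' : Dense ((mulSkew (mellin hN) frequency).domain : Set (L2Space N)) :=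
    hd.mono (eulerOp_le_mulSkew hN).1
  have hE := mulPVM_isSpectralMeasureOf (mellin hN) measurable_frequency
  have hexp : ∀ t, expSkew (eulerOp N).closure t = expOp (mellin hN) measurable_frequency t := by
    intro t
    have hex : ∃ E : ProjectionValuedMeasure (L2Space N),
        E.IsSpectralMeasureOf (Complex.I⁻¹ • (eulerOp N).closure) := ⟨_, h2 ▸ hE⟩
    -- By uniqueness, the spectral measure chosen in `expSkew` is the explicit one, so its integral
    -- is `expOp`.
    have hch : hex.choose = mulPVM (mellin hN) measurable_frequency :=
      eq_mulPVM_of_isSpectralMeasureOf _ _ hd' (by rw [← h2]; exact hex.choose_spec)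
    rw [expSkew, dif_pos hex, hch]
    exact (expOp_isIntegral (mellin hN) measurable_frequency t).integral_eq
  refine ⟨⟨hd, h1, ?_⟩, ⟨mulPVM (mellin hN) measurable_frequency, ?_, fun E hE' => ?_⟩, fun t => ?_⟩
  · rw [h2]
    exact mulSkew_adjoint _ measurable_frequency hd'
  · rw [h2]
    exact hE
  · rw [h2] at hE'
    exact eq_mulPVM_of_isSpectralMeasureOf _ _ hd' hE'
  · rw [hexp t]
    exact ⟨expOp_mem_unitary _ _ t, expOp_mellin_ae hN t⟩
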